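/- Let $\mathcal L$ be a three-sorted first-order language (sorts: valued field $\mathrm{VF}$, residue field $\mathrm{RF}$, value group $\mathrm{VG}$) containing the Denef–Pas language (ring language on $\mathrm{VF}$ and on $\mathrm{RF}$, $(+,<)$ on $\mathrm{VG}$, the valuation $\operatorname{ord}$ and an angular component map $\overline{\mathrm{ac}}$) and having no other sorts. Let $\mathcal T$ be an $\mathcal L$-theory all of whose models are Henselian valued fields with residue field of characteristic $0$ and an angular component map, and assume that $\mathcal T$ is split: in every model, with residue field $k$ and value group $\Gamma$, (i) each subset of $\Gamma^r$ definable with parameters is definable in the language $(+,<)$ with parameters from $\Gamma$, and (ii) for each finite set $A$ of parameters, each $A$-definable subset of $k^s\times\Gamma^r$ is a finite disjoint union of products $Y_i\times Z_i$ with $Y_i\subset k^s$ and $Z_i\subset\Gamma^r$ both $A$-definable. A $\mathcal T$-field is a model $K$ of $\mathcal T$ with value group $\mathbb Z$; $k_K$ denotes its residue field. Put $h[n,m,r](K)=K^n\times k_K^m\times\mathbb Z^r$. A definable subset $Z$ of $h[n,m,r]$ is a family of subsets $Z(K)\subset h[n,m,r](K)$, $K$ ranging over the $\mathcal T$-fields,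 given by one $\mathcal L$-formula without parameters; definable morphisms are families of maps with definable graph; $Z[0,m,0]=Z\times h[0,m,0]$; $|Z|$ is the collection of pairs $(K,z)$ with $K$ a $\mathcal T$-field and $z\in Z(K)$. Let $\mathbb A=\mathbb Z[\mathbb L,\mathbb L^{-1},(1-\mathbb L^{-i})^{-1}: i>0]$, and call $a\in\mathbb A$ nonnegative if $\vartheta_q(a)\ge 0$ for every real $q>1$, where $\vartheta_q:\mathbb A\to\mathbb R$ is the ring morphism with $\mathbb L\mapsto q$. Let $\mathcal P(Z)$ be the ring of functions $|Z|\to\mathbb A$ generated by the constants and by the functions $\alpha$ and $\mathbb L^{\alpha}$ for definable morphisms $\alpha:Z\to h[0,0,1]$; let $\mathcal P_+(Z)$ be the semiring of its functions with nonnegative values, and $\mathcal P_+^0(Z)\subset\mathcal P_+(Z)$ the sub-semiring generated by $\mathbb L-1$ and the characteristic functions $\mathbf 1_Y$ of definable subsets $Y\subset Z$. Let $\mathcal Q_+(Z)$ be the quotient of the free abelian monoid on symbols $[Y]$, for $Y$ a definable subset of some $Z[0,m,0]$, by the relations $[\emptyset]=0$; $[Y]=[Y']$ if $Y$ and $Y'$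 are definably isomorphic over $Z$; and $[Y\cup Y']+[Y\cap Y']=[Y]+[Y']$ for $Y,Y'\subset Z[0,m,0]$. It is a semiring with product given by the fiber product over $Z$. Let $\mathcal Q_+^*(Z)$ be the multiplicative set of classes $[Y]$ of those $Y$ all of whose fibers over the points of $Z$ are nonempty, and $\tilde{\mathcal Q}_+(Z)$ the localization of $\mathcal Q_+(Z)$ at $\mathcal Q_+^*(Z)$. Finally, using the semiring morphism $\mathcal P_+^0(Z)\to\mathcal Q_+(Z)$ that sends $\mathbf 1_Y$ to $[Y]$ and $\mathbb L-1$ to $[Z\times(\mathbb A^1\setminus\{0\})]$ (where $\mathbb A^1\setminus\{0\}\subset h[0,1,0]$ has $K$-points $k_K^\times$), set $$\mathcal C_+(Z)=\mathcal P_+(Z)\otimes_{\mathcal P_+^0(Z)}\mathcal Q_+(Z),\qquad \tilde{\mathcal C}_+(Z)=\mathcal P_+(Z)\otimes_{\mathcal P_+^0(Z)}\tilde{\mathcal Q}_+(Z).$$ **Proposition.** Let $r\ge 0$ and write $\mathbb Z^r=h[0,0,r]$. For every $F\in\tilde{\mathcal C}_+(\mathbb Z^r)$ there exist a class $[Y]\in\mathcal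 Q_+^*(h[0,0,0])\subset\mathcal Q_+(h[0,0,0])$ (so $Y(K)\neq\emptyset$ for all $\mathcal T$-fields $K$) and $G\in\mathcal C_+(\mathbb Z^r)$ such that $$\overline G=\overline{[Y]}\cdot F\quad\text{in }\tilde{\mathcal C}_+(\mathbb Z^r),$$ where $\overline G$ is the image of $G$ under the natural map $\mathcal C_+(\mathbb Z^r)\to\tilde{\mathcal C}_+(\mathbb Z^r)$, and $\overline{[Y]}$ is the image of $[Y]$ under the pullback $\mathcal Q_+(h[0,0,0])\to\mathcal Q_+(\mathbb Z^r)$, $[Y]\mapsto[Y\times\mathbb Z^r]$, followed by the natural map $\mathcal Q_+(\mathbb Z^r)\to\tilde{\mathcal C}_+(\mathbb Z^r)$. -/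

import Mathlib

universe u

namespace RatMot

open scoped TensorProduct

/-! ## Many-sorted languages expanding the language of Denef-Pas -/

/-- The three sorts: valued field, residue field, value group. -/
inductive Srt : Type
  | VF
  | RF
  | VG

open Srt

/-- The function symbols of the language of Denef-Pas, by argument sorts and value sort: a copy of
the ring language on `VF` and on `RF`, addition on `VG`, the valuation and the angular component. -/
inductive DPFunc : List Srt → Srt → Type
  | vfZero : DPFunc [] VF
  | vfOne : DPFunc [] VF
  | vfNeg : DPFunc [VF] VF
  | vfAdd : DPFunc [VF, VF] VF
  | vfMul : DPFunc [VF, VF] VF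
  | rfZero : DPFunc [] RF
  | rfOne : DPFunc [] RF
  | rfNeg : DPFunc [RF] RF
  | rfAdd : DPFunc [RF, RF] RF
  | rfMul : DPFunc [RF, RF] RF
  | vgAdd : DPFunc [VG, VG] VG
  | ord : DPFunc [VF] VG
  | ac : DPFunc [VF] RF

/-- The only relation symbol of the language of Denef-Pas, besides equality: the order on `VG`. -/
inductive DPRel : List Srt → Type
  | vgLt : DPRel [VG, VG]

/-- A language with the same sorts as the language of Denef-Pas and containing it, given by its
additional function and relation symbols. -/
structure Lang : Type (u + 1) where
  ExtraFunc : List Srt → Srt → Type u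
  ExtraRel : List Srt → Type u

/-- All function symbols. -/
def Lang.Func (L : Lang.{u}) (a : List Srt) (s : Srt) : Type u := DPFunc a s ⊕ L.ExtraFunc a s

/-- All relation symbols. -/
def Lang.Rel (L : Lang.{u}) (a : List Srt) : Type u := DPRel a ⊕ L.ExtraRel a

/-- An `L`-structure. -/
structure Struc (L : Lang.{u}) : Type (u + 1) where
  carrier : Srt → Type u
  func : ∀ {a : List Srt} {s : Srt}, L.Func a s → (∀ i : Fin a.length, carrier (a.get i)) → carrier s
  rel : ∀ {a : List Srt}, L.Rel a → (∀ i : Fin a.length, carrier (a.get i)) → Prop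

/-- De Bruijn variables of a given sort in a list of bound sorts. -/
inductive BVar : List Srt → Srt → Type
  | zero {Γ : List Srt} {s : Srt} : BVar (s :: Γ) s
  | succ {Γ : List Srt} {s t : Srt} : BVar Γ s → BVar (t :: Γ) s

/-- Terms with variables from the sorted family `V`. -/
inductive Term (L : Lang.{u}) (V : Srt → Type) : Srt → Type u
  | var {s : Srt} : V s → Term L V s
  | app {a : List Srt} {s : Srt} : L.Func a s → (∀ i : Fin a.length, Term L V (a.get i)) → Term L V s

/-- First-order formulas with free variables from the sorted family `V` and bound variables of the
sorts listed in the last argument. -/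
inductive Formula (L : Lang.{u}) (V : Srt → Type) : List Srt → Type u
  | falsum {Γ : List Srt} : Formula L V Γ
  | eq {Γ : List Srt} {s : Srt} : Term L (fun s => V s ⊕ BVar Γ s) s →
      Term L (fun s => V s ⊕ BVar Γ s) s → Formula L V Γ
  | rel {Γ : List Srt} {a : List Srt} : L.Rel a →
      (∀ i : Fin a.length, Term L (fun s => V s ⊕ BVar Γ s) (a.get i)) → Formula L V Γ
  | imp {Γ : List Srt} : Formula L V Γ → Formula L V Γ → Formula L V Γ
  | all {Γ : List Srt} (s : Srt) : Formula L V (s :: Γ) → Formula L V Γ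

/-- Sorted tuples of elements of the structure `M`, indexed by `V`. -/
abbrev Pt {L : Lang.{u}} (M : Struc L) (V : Srt → Type) : Type u := ∀ s : Srt, V s → M.carrier s

section Semantics

variable {L : Lang.{u}} {M : Struc L} {V W : Srt → Type}

/-- Concatenation of tuples. -/
def Pt.append (x : Pt M V) (y : Pt M W) : Pt M (fun s => V s ⊕ W s) :=
  fun s => Sum.elim (x s) (y s)

/-- Change of coordinates. -/
def Pt.reindex (ρ : ∀ s, V s → W s) (x : Pt M W) : Pt M V := fun s i => x s (ρ s i)

/-- Extend an assignment of bound variables by one value. -/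
def Pt.cons {Γ : List Srt} {t : Srt} (a : M.carrier t) (e : Pt M (BVar Γ)) : Pt M (BVar (t :: Γ))
  | _, .zero => a
  | s, .succ v => e s v

/-- The value of a term. -/
def Term.value (x : Pt M V) : ∀ {s : Srt}, Term L V s → M.carrier s
  | s, .var v => x s v
  | _, .app f ts => M.func f (fun i => (ts i).value x)

/-- Satisfaction of a formula. -/
def Formula.Holds (x : Pt M V) : ∀ {Γ : List Srt}, Formula L V Γ → Pt M (BVar Γ) → Prop
  | _, .falsum, _ => False
  | _, .eq t t', e => t.value (x.append e) = t'.value (x.append e)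
  | _, .rel R ts, e => M.rel R (fun i => (ts i).value (x.append e))
  | _, .imp φ ψ, e => φ.Holds x e → ψ.Holds x e
  | _, .all s φ, e => ∀ a : M.carrier s, φ.Holds x (Pt.cons a e)

/-- The empty assignment of bound variables. -/
def emptyEnv : Pt M (BVar []) := fun _ v => nomatch v

/-- Satisfaction of a formula without bound variables in scope. -/
def Formula.Realize (φ : Formula L V []) (x : Pt M V) : Prop := φ.Holds x emptyEnv

end Semantics

/-- A theory: a set of sentences. -/
abbrev Theory (L : Lang.{u}) : Type u := Set (Formula L (fun _ => Empty) [])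

/-- `M` is a model of `T`. -/
def Struc.IsModel {L : Lang.{u}} (M : Struc L) (T : Theory L) : Prop :=
  ∀ σ ∈ T, σ.Realize (M := M) (fun _ v => v.elim)

/-! ## The symbols of Denef-Pas in a structure -/

section DP

variable {L : Lang.{u}} (M : Struc L)

/-- A tuple of no arguments. -/
def args0 : ∀ i : Fin ([] : List Srt).length, M.carrier (([] : List Srt).get i) := fun i => i.elim0

variable {M}

/-- A tuple of one argument. -/
def args1 {s : Srt} (x : M.carrier s) : ∀ i : Fin [s].length, M.carrier ([s].get i)
  | ⟨0, _⟩ => x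

/-- A tuple of two arguments. -/
def args2 {s t : Srt} (x : M.carrier s) (y : M.carrier t) :
    ∀ i : Fin [s, t].length, M.carrier ([s, t].get i)
  | ⟨0, _⟩ => x
  | ⟨1, _⟩ => y

variable (M)

/-- The interpretation of a constant of the language of Denef-Pas. -/
def Struc.dp0 {s : Srt} (f : DPFunc [] s) : M.carrier s := M.func (Sum.inl f) (args0 M)

/-- The interpretation of a unary function symbol of the language of Denef-Pas. -/
def Struc.dp1 {s t : Srt} (f : DPFunc [s] t) (x : M.carrier s) : M.carrier t :=
  M.func (Sum.inl f) (args1 x)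

/-- The interpretation of a binary function symbol of the language of Denef-Pas. -/
def Struc.dp2 {s s' t : Srt} (f : DPFunc [s, s'] t) (x : M.carrier s) (y : M.carrier s') :
    M.carrier t := M.func (Sum.inl f) (args2 x y)

/-- The order relation of the sort `VG`. -/
def Struc.vgLt (x y : M.carrier VG) : Prop := M.rel (Sum.inl DPRel.vgLt) (args2 x y)

/-- `M` is, in its Denef-Pas part, a Henselian valued field (the sort `VF`) with residue field of
characteristic zero (the sort `RF`), value group `VG`, valuation `ord` (with the convention
`ord 0 = 0` for the value at `0`) and an angular component map `ac`. -/
def Struc.IsHenselianAC0 : Prop :=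
  ∃ (_ : Field (M.carrier VF)) (_ : Field (M.carrier RF)) (_ : AddCommGroup (M.carrier VG))
    (_ : LinearOrder (M.carrier VG)) (_ : IsOrderedAddMonoid (M.carrier VG))
    (O : ValuationSubring (M.carrier VF)) (res : IsLocalRing.ResidueField O ≃+* M.carrier RF),
    -- the symbols of the ring languages and of the language of ordered groups
    (M.dp0 .vfZero = 0 ∧ M.dp0 .vfOne = 1 ∧ (∀ x, M.dp1 .vfNeg x = -x) ∧
      (∀ x y, M.dp2 .vfAdd x y = x + y) ∧ (∀ x y, M.dp2 .vfMul x y = x * y)) ∧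
    (M.dp0 .rfZero = 0 ∧ M.dp0 .rfOne = 1 ∧ (∀ x, M.dp1 .rfNeg x = -x) ∧
      (∀ x y, M.dp2 .rfAdd x y = x + y) ∧ (∀ x y, M.dp2 .rfMul x y = x * y)) ∧
    ((∀ x y, M.dp2 .vgAdd x y = x + y) ∧ (∀ x y, M.vgLt x y ↔ x < y)) ∧
    -- `ord` is a valuation with value group `VG` and valuation ring `O`
    (M.dp1 .ord 0 = 0 ∧
      (∀ x y, x ≠ 0 → y ≠ 0 → M.dp1 .ord (x * y) = M.dp1 .ord x + M.dp1 .ord y) ∧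
      (∀ γ, ∃ x, x ≠ 0 ∧ M.dp1 .ord x = γ) ∧
      (∀ x, x ∈ O ↔ x = 0 ∨ 0 ≤ M.dp1 .ord x)) ∧
    -- `ac` is an angular component map
    (M.dp1 .ac 0 = 0 ∧ (∀ x y, M.dp1 .ac (x * y) = M.dp1 .ac x * M.dp1 .ac y) ∧
      (∀ x : O, (x : M.carrier VF) ≠ 0 → M.dp1 .ord (x : M.carrier VF) = 0 →
        M.dp1 .ac (x : M.carrier VF) = res (IsLocalRing.residue O x))) ∧
    HenselianLocalRing O ∧ CharZero (M.carrier RF)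

end DP

/-! ## Definable sets with parameters, split theories -/

/-- The index family of `h[n,m,r]`: `n` variables of sort `VF`, `m` of sort `RF`, `r` of sort
`VG`. -/
def hIdx (n m r : ℕ) : Srt → Type
  | VF => Fin n
  | RF => Fin m
  | VG => Fin r

/-- Definability with parameters from `A`. -/
def Struc.DefinableOver {L : Lang.{u}} (M : Struc L) (A : ∀ s, Set (M.carrier s))
    {V : Srt → Type} (X : Set (Pt M V)) : Prop :=
  ∃ (n m r : ℕ) (c : Pt M (hIdx n m r)) (φ : Formula L (fun s => V s ⊕ hIdx n m r s) []),
    (∀ s i, c s i ∈ A s) ∧ X = {x | φ.Realize (x.append c)}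

/-- The function symbol of the one-sorted language `(+, <)`. -/
inductive OagFunc : ℕ → Type
  | add : OagFunc 2

/-- The relation symbol of the one-sorted language `(+, <)`. -/
inductive OagRel : ℕ → Type
  | lt : OagRel 2

/-- The one-sorted language `(+, <)` of ordered abelian groups. -/
def oagLang : FirstOrder.Language.{0, 0} where
  Functions := OagFunc
  Relations := OagRel

/-- The value group as a structure in the language `(+, <)`. -/
@[reducible]
def Struc.oagStructure {L : Lang.{u}} (M : Struc L) : oagLang.Structure (M.carrier VG) where
  funMap := fun {_} f => match f with
    | OagFunc.add => fun x => M.dp2 .vgAdd (x 0) (x 1)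
  RelMap := fun {_} R => match R with
    | OagRel.lt => fun x => M.vgLt (x 0) (x 1)

/-- A subset of `Γ^r` as a subset of `h[0,0,r]`. -/
def vgSet {L : Lang.{u}} {M : Struc L} {r : ℕ} (Z : Set (Fin r → M.carrier VG)) :
    Set (Pt M (hIdx 0 0 r)) := {x | x VG ∈ Z}

/-- A subset of `k^s` as a subset of `h[0,s,0]`. -/
def rfSet {L : Lang.{u}} {M : Struc L} {s : ℕ} (Y : Set (Fin s → M.carrier RF)) :
    Set (Pt M (hIdx 0 s 0)) := {x | x RF ∈ Y}

/-- A subset of `k^s × Γ^r` as a subset of `h[0,s,r]`. -/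
def rfvgSet {L : Lang.{u}} {M : Struc L} {s r : ℕ}
    (X : Set ((Fin s → M.carrier RF) × (Fin r → M.carrier VG))) :
    Set (Pt M (hIdx 0 s r)) := {x | (x RF, x VG) ∈ X}

/-- Split theories. -/
structure IsSplit {L : Lang.{u}} (T : Theory L) : Prop where
  /-- Subsets of `Γ^r` definable with parameters from the whole structure are definable in the
  language `(+, <)` with parameters from `Γ`. -/
  valueGroup : ∀ M : Struc L, M.IsModel T → ∀ (r : ℕ) (Z : Set (Fin r → M.carrier VG)),
    M.DefinableOver (fun _ => Set.univ) (vgSet Z) →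
      letI := M.oagStructure
      (Set.univ : Set (M.carrier VG)).Definable oagLang Z
  /-- Definable subsets of `k^s × Γ^r` are finite disjoint unions of definable rectangles. -/
  orthogonal : ∀ M : Struc L, M.IsModel T → ∀ (A : ∀ s, Set (M.carrier s)), (∀ s, (A s).Finite) →
    ∀ (s r : ℕ) (X : Set ((Fin s → M.carrier RF) × (Fin r → M.carrier VG))),
    M.DefinableOver A (rfvgSet X) →
      ∃ (N : ℕ) (Y : Fin N → Set (Fin s → M.carrier RF)) (Z : Fin N → Set (Fin r → M.carrier VG)),
        (∀ i, M.DefinableOver A (rfSet (Y i))) ∧ (∀ i, M.DefinableOver A (vgSet (Z i))) ∧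
        Pairwise (fun i j => Disjoint (Y i ×ˢ Z i) (Y j ×ˢ Z j)) ∧ X = ⋃ i, Y i ×ˢ Z i

/-! ## The category of definable subsets -/

/-- A `T`-field: a model of `T` with value group `ℤ` (the identification of the ordered group `VG`
with `ℤ` is unique). -/
structure TField {L : Lang.{u}} (T : Theory L) : Type (u + 1) extends Struc L where
  isModel : toStruc.IsModel T
  toInt : toStruc.carrier VG ≃ ℤ
  toInt_add : ∀ x y, toInt (toStruc.dp2 .vgAdd x y) = toInt x + toInt y
  toInt_lt : ∀ x y, toStruc.vgLt x y ↔ toInt x < toInt y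

section Definable

variable {L : Lang.{u}} {T : Theory L} {V W : Srt → Type}

/-- A family of subsets, one for each `T`-field, is definable if it is given by one formula. -/
def IsDef (X : ∀ K : TField T, Set (Pt K.toStruc V)) : Prop :=
  ∃ φ : Formula L V [], ∀ K : TField T, X K = {x | φ.Realize x}

end Definable

/-- Definable subsets, with coordinates indexed by `V`. -/
@[ext]
structure DefSet {L : Lang.{u}} (T : Theory L) (V : Srt → Type) : Type (u + 1) where
  pts : ∀ K : TField T, Set (Pt K.toStruc V)
  isDef : IsDef pts

/-! ### Closure properties of definability -/

section Closure

variable {L : Lang.{u}} {T : Theory L} {V W : Srt → Type}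

/-- Renaming of variables in terms. -/
def Term.rename (ρ : ∀ s, V s → W s) : ∀ {s : Srt}, Term L V s → Term L W s
  | s, .var v => .var (ρ s v)
  | _, .app f ts => .app f (fun i => (ts i).rename ρ)

/-- Renaming of free variables in formulas. -/
def Formula.rename (ρ : ∀ s, V s → W s) : ∀ {Γ : List Srt}, Formula L V Γ → Formula L W Γ
  | _, .falsum => .falsum
  | _, .eq t t' => .eq (t.rename fun s => Sum.map (ρ s) id) (t'.rename fun s => Sum.map (ρ s) id)
  | _, .rel R ts => .rel R (fun i => (ts i).rename fun s => Sum.map (ρ s) id)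
  | _, .imp φ ψ => .imp (φ.rename ρ) (ψ.rename ρ)
  | _, .all s φ => .all s (φ.rename ρ)

theorem Term.value_rename {M : Struc L} (ρ : ∀ s, V s → W s) (x : Pt M W) {s : Srt}
    (t : Term L V s) : (t.rename ρ).value x = t.value (x.reindex ρ) := by
  induction t with
  | var v => rfl
  | app f ts ih => simp only [Term.rename, Term.value, ih]

theorem Pt.append_reindex_map {M : Struc L} {U : Srt → Type} (ρ : ∀ s, V s → W s) (x : Pt M W)
    (e : Pt M U) : (x.append e).reindex (fun s => Sum.map (ρ s) id) = (x.reindex ρ).append e := by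
  funext s i
  cases i <;> rfl

theorem Formula.holds_rename {M : Struc L} (ρ : ∀ s, V s → W s) (x : Pt M W) {Γ : List Srt}
    (φ : Formula L V Γ) : ∀ e, (φ.rename ρ).Holds x e ↔ φ.Holds (x.reindex ρ) e := by
  induction φ with
  | falsum => intro e; rfl
  | eq t t' => intro e; simp only [Formula.rename, Formula.Holds, Term.value_rename,
      Pt.append_reindex_map]
  | rel R ts => intro e; simp only [Formula.rename, Formula.Holds, Term.value_rename,
      Pt.append_reindex_map]
  | imp φ ψ h1 h2 => intro e; simp only [Formula.rename, Formula.Holds, h1, h2]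
  | all s φ h => intro e; simp only [Formula.rename, Formula.Holds, h]

theorem IsDef.reindex {X : ∀ K : TField T, Set (Pt K.toStruc V)} (hX : IsDef X)
    (ρ : ∀ s, V s → W s) : IsDef (T := T) (fun K => {x : Pt K.toStruc W | x.reindex ρ ∈ X K}) := by
  obtain ⟨φ, hφ⟩ := hX
  refine ⟨φ.rename ρ, fun K => ?_⟩
  ext x
  simp only [Set.mem_ofPred_eq, hφ, Formula.Realize, Formula.holds_rename]

theorem IsDef.empty : IsDef (T := T) (V := V) (fun _ => ∅) :=
  ⟨.falsum, fun _ => rfl⟩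

theorem IsDef.compl {X : ∀ K : TField T, Set (Pt K.toStruc V)} (hX : IsDef X) :
    IsDef (fun K => (X K)ᶜ) := by
  obtain ⟨φ, hφ⟩ := hX
  refine ⟨.imp φ .falsum, fun K => ?_⟩
  ext x
  simp only [hφ]
  rfl

theorem IsDef.univ : IsDef (T := T) (V := V) (fun _ => Set.univ) := by
  simpa using (IsDef.empty (T := T) (V := V)).compl

theorem IsDef.union {X Y : ∀ K : TField T, Set (Pt K.toStruc V)} (hX : IsDef X) (hY : IsDef Y) :
    IsDef (fun K => X K ∪ Y K) := by
  obtain ⟨φ, hφ⟩ := hX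
  obtain ⟨ψ, hψ⟩ := hY
  refine ⟨.imp (.imp φ .falsum) ψ, fun K => ?_⟩
  ext x
  simp only [hφ, hψ, Set.mem_union, Set.mem_ofPred_eq, Formula.Realize, Formula.Holds]
  tauto

theorem IsDef.inter {X Y : ∀ K : TField T, Set (Pt K.toStruc V)} (hX : IsDef X) (hY : IsDef Y) :
    IsDef (fun K => X K ∩ Y K) := by
  simpa [Set.compl_union] using (hX.compl.union hY.compl).compl

theorem IsDef.eqCoord {s : Srt} (i j : V s) :
    IsDef (T := T) (fun K => {x : Pt K.toStruc V | x s i = x s j}) :=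
  ⟨.eq (.var (Sum.inl i)) (.var (Sum.inl j)), fun _ => rfl⟩

theorem IsDef.iInter {ι : Type} [Finite ι] {X : ι → ∀ K : TField T, Set (Pt K.toStruc V)}
    (hX : ∀ i, IsDef (X i)) : IsDef (fun K => ⋂ i, X i K) := by
  classical
  have := Fintype.ofFinite ι
  have key : ∀ S : Finset ι, IsDef (fun K => ⋂ i ∈ S, X i K) := by
    intro S
    induction S using Finset.induction_on with
    | empty => simpa using IsDef.univ
    | insert a S _ ih => simpa [Finset.set_biInter_insert] using (hX a).inter ih
  simpa using key Finset.univ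

theorem Srt.finite : Finite Srt :=
  Finite.of_surjective (fun i : Fin 3 => match i with | 0 => VF | 1 => RF | 2 => VG) (by
    intro s
    cases s
    · exact ⟨0, rfl⟩
    · exact ⟨1, rfl⟩
    · exact ⟨2, rfl⟩)

theorem IsDef.eqTuple [∀ s, Finite (V s)] (f g : ∀ s, V s → W s) :
    IsDef (T := T) (fun K => {x : Pt K.toStruc W | x.reindex f = x.reindex g}) := by
  have := Srt.finite
  have H : IsDef (T := T) (fun K => ⋂ i : Σ s, V s, {x : Pt K.toStruc W |
      x i.1 (f i.1 i.2) = x i.1 (g i.1 i.2)}) :=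
    IsDef.iInter fun i => IsDef.eqCoord _ _
  convert H using 2 with K
  ext x
  simp only [Set.mem_iInter, Set.mem_ofPred_eq, Sigma.forall, funext_iff, Pt.reindex]

end Closure

/-! ### Operations on definable subsets -/

namespace DefSet

variable {L : Lang.{u}} {T : Theory L} {V W : Srt → Type}

instance : Union (DefSet T V) := ⟨fun X Y => ⟨fun K => X.pts K ∪ Y.pts K, X.isDef.union Y.isDef⟩⟩

instance : Inter (DefSet T V) := ⟨fun X Y => ⟨fun K => X.pts K ∩ Y.pts K, X.isDef.inter Y.isDef⟩⟩

/-- The preimage under a change of coordinates. -/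
def comap (X : DefSet T V) (ρ : ∀ s, V s → W s) : DefSet T W :=
  ⟨fun K => {x | x.reindex ρ ∈ X.pts K}, X.isDef.reindex ρ⟩

end DefSet

/-- The definable subset `h[n,m,r]`, with `h[n,m,r](K) = K^n × k_K^m × ℤ^r`. -/
def h {L : Lang.{u}} (T : Theory L) (n m r : ℕ) : DefSet T (hIdx n m r) :=
  ⟨fun _ => Set.univ, IsDef.univ⟩

/-- Definable morphisms: families of functions whose graphs form a definable subset. -/
structure Mor {L : Lang.{u}} {T : Theory L} {V W : Srt → Type} (X : DefSet T V) (Y : DefSet T W) :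
    Type (u + 1) where
  toFun : ∀ K : TField T, X.pts K → Y.pts K
  graph : IsDef (T := T) (V := fun s => V s ⊕ W s) (fun K =>
    {p | ∃ x : X.pts K, p = Pt.append (x : Pt K.toStruc V) (toFun K x : Pt K.toStruc W)})

/-- The points `|Z|` of a definable subset. -/
abbrev Points {L : Lang.{u}} {T : Theory L} {V : Srt → Type} (Z : DefSet T V) : Type (u + 1) :=
  Σ K : TField T, Z.pts K

/-! ## Constructible Presburger functions -/

section Presburger

open RatFunc in
/-- The ring `𝔸 = ℤ[𝕃, 𝕃⁻¹, (1 - 𝕃⁻ⁱ)⁻¹ : i > 0]` inside the field of rational functions in `𝕃`. -/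
noncomputable def ringA : Subring (RatFunc ℚ) :=
  Subring.closure ({X, X⁻¹} ∪ {f | ∃ i : ℕ, 0 < i ∧ f = (1 - (X⁻¹) ^ i)⁻¹})

/-- The element `𝕃` of `𝔸`. -/
noncomputable def LL : ringA := ⟨RatFunc.X, Subring.subset_closure (by simp)⟩

/-- The element `𝕃⁻¹` of `𝔸`. -/
noncomputable def LLinv : ringA := ⟨RatFunc.X⁻¹, Subring.subset_closure (by simp)⟩

theorem LL_mul_LLinv : LL * LLinv = 1 :=
  Subtype.ext (mul_inv_cancel₀ RatFunc.X_ne_zero)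

/-- `𝕃` as a unit of `𝔸`. -/
noncomputable def LLunit : ringAˣ :=
  ⟨LL, LLinv, LL_mul_LLinv, by rw [mul_comm]; exact LL_mul_LLinv⟩

/-- `a ∈ 𝔸` is nonnegative if `ϑ_q(a) ≥ 0` for each real `q > 1`, where `ϑ_q : 𝔸 → ℝ` is the ring
morphism sending `𝕃` to `q`. -/
def NonnegA (a : ringA) : Prop := ∀ (q : ℝ), 1 < q → ∀ ϑ : ringA →+* ℝ, ϑ LL = q → 0 ≤ ϑ a

variable {L : Lang.{u}} {T : Theory L} {V : Srt → Type} (Z : DefSet T V)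

variable {Z} in
/-- The integer-valued function on points attached to a definable morphism to `h[0,0,1]`. -/
def Mor.hat (α : Mor Z (h T 0 0 1)) : Points Z → ℤ :=
  fun p => p.1.toInt ((α.toFun p.1 p.2 : Pt p.1.toStruc (hIdx 0 0 1)) VG (0 : Fin 1))

/-- The ring `𝒫(Z)` of constructible Presburger functions on `Z`. -/
noncomputable def ringP : Subring (Points Z → ringA) :=
  Subring.closure
    ({f | ∃ a : ringA, f = fun _ => a} ∪
     {f | ∃ α : Mor Z (h T 0 0 1), f = fun p => (α.hat p : ringA)} ∪
     {f | ∃ β : Mor Z (h T 0 0 1), f = fun p => ((LLunit ^ β.hat p : ringAˣ) : ringA)})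

/-- The semiring `𝒫₊(Z)` of functions in `𝒫(Z)` with nonnegative values. -/
noncomputable def PPlus : Subsemiring (Points Z → ringA) where
  carrier := {f | f ∈ ringP Z ∧ ∀ p, NonnegA (f p)}
  zero_mem' := ⟨zero_mem _, fun _ _ _ ϑ _ => by simp⟩
  one_mem' := ⟨one_mem _, fun _ _ _ ϑ _ => by simp⟩
  add_mem' := fun {f g} hf hg => ⟨add_mem hf.1 hg.1, fun p q hq ϑ hϑ => by
    simpa using add_nonneg (hf.2 p q hq ϑ hϑ) (hg.2 p q hq ϑ hϑ)⟩
  mul_mem' := fun {f g} hf hg => ⟨mul_mem hf.1 hg.1, fun p q hq ϑ hϑ => by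
    simpa using mul_nonneg (hf.2 p q hq ϑ hϑ) (hg.2 p q hq ϑ hϑ)⟩

variable {Z} in
open Classical in
/-- The characteristic function `𝟏_Y` on `Z`. -/
noncomputable def charFn (Y : DefSet T V) : Points Z → ringA :=
  fun p => if (p.2 : Pt p.1.toStruc V) ∈ Y.pts p.1 then 1 else 0

/-- The sub-semiring `𝒫₊⁰(Z)` of `𝒫₊(Z)` generated by the characteristic functions of definable
subsets of `Z` and by the constant function `𝕃 - 1`. -/
noncomputable def PZero : Subsemiring (PPlus Z) :=
  Subsemiring.closure
    ({f | ∃ Y : DefSet T V, (∀ K, Y.pts K ⊆ Z.pts K) ∧ (f : Points Z → ringA) = charFn Y} ∪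
     {f | (f : Points Z → ringA) = fun _ => LL - 1})

end Presburger


/-! ## The semiring `𝒬₊(Z)` -/

instance hIdx_finite (n m r : ℕ) (s : Srt) : Finite (hIdx n m r s) := by
  cases s <;> simp only [hIdx] <;> infer_instance

/-- Coordinates of `Z[0,m,0]`, where `V` are the coordinates of `Z`. -/
abbrev relIdx (V : Srt → Type) (m : ℕ) : Srt → Type := fun s => V s ⊕ hIdx 0 m 0 s

/-- Renaming of residue field coordinates. -/
def rfMap {m m' : ℕ} (f : Fin m → Fin m') : ∀ s, hIdx 0 m 0 s → hIdx 0 m' 0 s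
  | VF => id
  | RF => f
  | VG => id

/-- Renaming of the residue field coordinates in the fibers of `Z[0,m,0]`. -/
def relMap (V : Srt → Type) {m m' : ℕ} (f : Fin m → Fin m') : ∀ s, relIdx V m s → relIdx V m' s
  | _, .inl i => .inl i
  | s, .inr i => .inr (rfMap f s i)

/-- The projection from `Z[0,m,0]` to `Z`. -/
def Pt.base {L : Lang.{u}} {M : Struc L} {V : Srt → Type} {m : ℕ} (x : Pt M (relIdx V m)) :
    Pt M V := x.reindex (fun _ => Sum.inl)

theorem Pt.reindex_relMap {L : Lang.{u}} {M : Struc L} {V : Srt → Type} {m m' m'' : ℕ}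
    (x : Pt M (relIdx V m'')) (f : Fin m → Fin m') (g : Fin m' → Fin m'') :
    (x.reindex (relMap V g)).reindex (relMap V f) = x.reindex (relMap V (g ∘ f)) := by
  funext s i
  rcases i with i | i
  · rfl
  · cases s <;> rfl

theorem Pt.reindex_relMap_id {L : Lang.{u}} {M : Struc L} {V : Srt → Type} {m : ℕ}
    (x : Pt M (relIdx V m)) : x.reindex (relMap V id) = x := by
  funext s i
  rcases i with i | i
  · rfl
  · cases s <;> rfl

/-- The symbols `[Y]`: definable subsets `Y` of `Z[0,m,0]` for some `m ≥ 0`. -/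
structure Sym {L : Lang.{u}} {T : Theory L} {V : Srt → Type} (Z : DefSet T V) : Type (u + 1) where
  m : ℕ
  set : DefSet T (relIdx V m)
  sub : ∀ K, ∀ x ∈ set.pts K, x.base ∈ Z.pts K

namespace Sym

variable {L : Lang.{u}} {T : Theory L} {V : Srt → Type} {Z : DefSet T V}

/-- Isomorphism over `Z`. -/
def Iso (Y Y' : Sym Z) : Prop :=
  ∃ f : Mor Y.set Y'.set, (∀ K, Function.Bijective (f.toFun K)) ∧
    ∀ K y, Pt.base (f.toFun K y : Pt K.toStruc (relIdx V Y'.m)) =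
      Pt.base (y : Pt K.toStruc (relIdx V Y.m))

/-- The fiber product over `Z`. -/
abbrev prod (Y Y' : Sym Z) : Sym Z where
  m := Y.m + Y'.m
  set := Y.set.comap (relMap V (Fin.castAdd Y'.m)) ∩ Y'.set.comap (relMap V (Fin.natAdd Y.m))
  sub := fun K _ hx => Y.sub K _ hx.1

variable (Z) in
/-- A definable subset of `Z`, as a definable subset of `Z[0,0,0]`. -/
abbrev ofSubset (Y : DefSet T V) (hY : ∀ K, Y.pts K ⊆ Z.pts K) : Sym Z where
  m := 0
  set := Y.comap (fun _ => Sum.inl)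
  sub := fun K _ hx => hY K hx

variable (Z) in
/-- The identity `Z → Z`. -/
abbrev self : Sym Z := ofSubset Z Z (fun _ => subset_rfl)

end Sym

section Q

variable {L : Lang.{u}} {T : Theory L} {V : Srt → Type} (Z : DefSet T V)

/-- The relations defining `𝒬₊(Z)` as a quotient of the free abelian monoid on the symbols. -/
inductive QRel : (Sym Z →₀ ℕ) → (Sym Z →₀ ℕ) → Prop
  | empty (Y : Sym Z) (hY : ∀ K, Y.set.pts K = ∅) : QRel (Finsupp.single Y 1) 0
  | iso (Y Y' : Sym Z) (hY : Y.Iso Y') : QRel (Finsupp.single Y 1) (Finsupp.single Y' 1)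
  | union (m : ℕ) (Y Y' : DefSet T (relIdx V m)) (hY : ∀ K, ∀ x ∈ Y.pts K, x.base ∈ Z.pts K)
      (hY' : ∀ K, ∀ x ∈ Y'.pts K, x.base ∈ Z.pts K) :
      QRel (Finsupp.single ⟨m, Y ∪ Y', fun K x hx => hx.elim (hY K x) (hY' K x)⟩ 1 +
          Finsupp.single ⟨m, Y ∩ Y', fun K x hx => hY K x hx.1⟩ 1)
        (Finsupp.single ⟨m, Y, hY⟩ 1 + Finsupp.single ⟨m, Y', hY'⟩ 1)

/-- The semiring `𝒬₊(Z)`. -/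
def Q : Type (u + 1) := (addConGen (QRel Z)).Quotient

noncomputable instance : AddCommMonoid (Q Z) :=
  inferInstanceAs (AddCommMonoid (addConGen (QRel Z)).Quotient)

variable {Z}

/-- The class `[Y]` in `𝒬₊(Z)`. -/
noncomputable def Sym.cls (Y : Sym Z) : Q Z := (addConGen (QRel Z)).mk' (Finsupp.single Y 1)

theorem Sym.cls_empty (Y : Sym Z) (hY : ∀ K, Y.set.pts K = ∅) : Y.cls = 0 :=
  (AddCon.eq _).2 (AddConGen.Rel.of _ _ (QRel.empty Y hY))

theorem Sym.cls_iso {Y Y' : Sym Z} (hY : Y.Iso Y') : Y.cls = Y'.cls :=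
  (AddCon.eq _).2 (AddConGen.Rel.of _ _ (QRel.iso Y Y' hY))

theorem Sym.cls_union (m : ℕ) (Y Y' : DefSet T (relIdx V m))
    (hY : ∀ K, ∀ x ∈ Y.pts K, x.base ∈ Z.pts K) (hY' : ∀ K, ∀ x ∈ Y'.pts K, x.base ∈ Z.pts K) :
    Sym.cls (Z := Z) ⟨m, Y ∪ Y', fun K x hx => hx.elim (hY K x) (hY' K x)⟩ +
      Sym.cls (Z := Z) ⟨m, Y ∩ Y', fun K x hx => hY K x hx.1⟩ =
    Sym.cls (Z := Z) ⟨m, Y, hY⟩ + Sym.cls (Z := Z) ⟨m, Y', hY'⟩ :=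
  (AddCon.eq _).2 (AddConGen.Rel.of _ _ (QRel.union m Y Y' hY hY'))

/-- Additive maps out of `𝒬₊(Z)`. -/
noncomputable def Q.lift {N : Type*} [AddCommMonoid N] (f : Sym Z → N)
    (h0 : ∀ Y : Sym Z, (∀ K, Y.set.pts K = ∅) → f Y = 0)
    (h1 : ∀ Y Y' : Sym Z, Y.Iso Y' → f Y = f Y')
    (h2 : ∀ (m : ℕ) (Y Y' : DefSet T (relIdx V m))
      (hY : ∀ K, ∀ x ∈ Y.pts K, x.base ∈ Z.pts K) (hY' : ∀ K, ∀ x ∈ Y'.pts K, x.base ∈ Z.pts K),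
      f ⟨m, Y ∪ Y', fun K x hx => hx.elim (hY K x) (hY' K x)⟩ +
        f ⟨m, Y ∩ Y', fun K x hx => hY K x hx.1⟩ = f ⟨m, Y, hY⟩ + f ⟨m, Y', hY'⟩) :
    Q Z →+ N :=
  (addConGen (QRel Z)).lift (Finsupp.liftAddHom fun Y => (multiplesHom N (f Y))) (by
    refine AddCon.addConGen_le.2 fun x y hxy => ?_
    rw [AddCon.ker_rel]
    cases hxy with
    | empty Y hY => simpa using h0 Y hY
    | iso Y Y' hY => simpa using h1 Y Y' hY
    | union m Y Y' hY hY' => simpa using h2 m Y Y' hY hY')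

theorem Q.lift_cls {N : Type*} [AddCommMonoid N] (f : Sym Z → N) (h0 h1 h2) (Y : Sym Z) :
    Q.lift f h0 h1 h2 Y.cls = f Y := by
  change Finsupp.liftAddHom (fun Y => (multiplesHom N (f Y))) (Finsupp.single Y 1) = f Y
  simp

theorem Q.hom_ext {N : Type*} [AddCommMonoid N] {f g : Q Z →+ N}
    (hfg : ∀ Y : Sym Z, f Y.cls = g Y.cls) : f = g := by
  refine AddCon.hom_ext ?_
  refine Finsupp.addHom_ext' fun Y => ?_
  ext
  exact hfg Y

theorem Sym.ext' {m : ℕ} {Y Y' : DefSet T (relIdx V m)} (hY hY')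
    (h : ∀ K, Y.pts K = Y'.pts K) : (⟨m, Y, hY⟩ : Sym Z) = ⟨m, Y', hY'⟩ := by
  have : Y = Y' := DefSet.ext (funext h)
  subst this
  rfl

/-- The point of a fiber product with given components. -/
def Pt.join {M : Struc L} {m m' : ℕ} (x : Pt M (relIdx V m)) (y : Pt M (relIdx V m')) :
    Pt M (relIdx V (m + m'))
  | s, Sum.inl i => x s (Sum.inl i)
  | RF, Sum.inr i => Fin.addCases (motive := fun _ => M.carrier RF)
      (fun j => x RF (Sum.inr j)) (fun j => y RF (Sum.inr j)) i
  | VF, Sum.inr i => x VF (Sum.inr i)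
  | VG, Sum.inr i => x VG (Sum.inr i)

theorem Pt.join_left {M : Struc L} {m m' : ℕ} (x : Pt M (relIdx V m)) (y : Pt M (relIdx V m')) :
    (x.join y).reindex (relMap V (Fin.castAdd m')) = x := by
  funext s i
  rcases i with i | i
  · rfl
  · cases s
    · rfl
    · exact Fin.addCases_left (motive := fun _ => M.carrier RF) (left := fun j => x RF (Sum.inr j))
        (right := fun j => y RF (Sum.inr j)) i
    · rfl

theorem Pt.join_right {M : Struc L} {m m' : ℕ} (x : Pt M (relIdx V m)) (y : Pt M (relIdx V m'))
    (hxy : x.base = y.base) : (x.join y).reindex (relMap V (Fin.natAdd m)) = y := by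
  funext s i
  rcases i with i | i
  · exact congrFun (congrFun hxy s) i
  · cases s
    · exact Fin.elim0 i
    · exact Fin.addCases_right (motive := fun _ => M.carrier RF) (left := fun j => x RF (Sum.inr j))
        (right := fun j => y RF (Sum.inr j)) i
    · exact Fin.elim0 i

theorem Pt.ext_join {M : Struc L} {m m' : ℕ} (x y : Pt M (relIdx V (m + m')))
    (h1 : x.reindex (relMap V (Fin.castAdd m')) = y.reindex (relMap V (Fin.castAdd m')))
    (h2 : x.reindex (relMap V (Fin.natAdd m)) = y.reindex (relMap V (Fin.natAdd m))) : x = y := by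
  funext s i
  rcases i with i | i
  · exact congrFun (congrFun h1 s) (Sum.inl i)
  · cases s
    · exact Fin.elim0 i
    · exact Fin.addCases (motive := fun i => x RF (Sum.inr i) = y RF (Sum.inr i))
        (fun j => congrFun (congrFun h1 RF) (Sum.inr j))
        (fun j => congrFun (congrFun h2 RF) (Sum.inr j)) i
    · exact Fin.elim0 i

section Isos

variable [∀ s, Finite (V s)]

theorem Sym.Iso.of_perm (Y Y' : Sym Z) (σ : Fin Y.m ≃ Fin Y'.m)
    (hY : ∀ K x, x ∈ Y'.set.pts K ↔ Pt.reindex (relMap V σ) x ∈ Y.set.pts K) : Y'.Iso Y := by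
  refine ⟨⟨fun K x => ⟨Pt.reindex (relMap V σ) x.1, (hY K x.1).1 x.2⟩, ?_⟩, fun K => ⟨?_, ?_⟩, ?_⟩
  · convert (Y'.set.isDef.reindex (W := fun s => relIdx V Y'.m s ⊕ relIdx V Y.m s)
      (fun s => Sum.inl)).inter
      (IsDef.eqTuple (T := T) (V := relIdx V Y.m) (W := fun s => relIdx V Y'.m s ⊕ relIdx V Y.m s)
        (fun s => Sum.inr) (fun s i => Sum.inl (relMap V σ s i))) using 2 with K
    ext p
    constructor
    · rintro ⟨x, rfl⟩
      exact ⟨x.2, rfl⟩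
    · rintro ⟨h1, h2⟩
      refine ⟨⟨_, h1⟩, ?_⟩
      funext s i
      rcases i with i | i
      · rfl
      · exact congrFun (congrFun h2 s) i
  · intro x y hxy
    have h := congrArg (fun z => Pt.reindex (relMap V σ.symm) z.1) hxy
    simp only [Pt.reindex_relMap, Equiv.self_comp_symm, Pt.reindex_relMap_id] at h
    exact Subtype.ext h
  · intro x
    refine ⟨⟨Pt.reindex (relMap V σ.symm) x.1, ?_⟩, ?_⟩
    · rw [hY, Pt.reindex_relMap, Equiv.symm_comp_self, Pt.reindex_relMap_id]
      exact x.2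
    · refine Subtype.ext ?_
      simp only [Pt.reindex_relMap, Equiv.symm_comp_self, Pt.reindex_relMap_id]
  · intro K x
    rfl

theorem Sym.Iso.prod {Y Y' : Sym Z} (hY : Y.Iso Y') (W : Sym Z) : (Y.prod W).Iso (Y'.prod W) := by
  obtain ⟨f, hf, hb⟩ := hY
  have hbase : ∀ K (x : (Y.prod W).set.pts K),
      Pt.base (f.toFun K ⟨Pt.reindex (relMap V (Fin.castAdd W.m)) x.1, x.2.1⟩ :
        Pt K.toStruc (relIdx V Y'.m)) =
      Pt.base (Pt.reindex (relMap V (Fin.natAdd Y.m)) (M := K.toStruc) x.1) :=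
    fun K x => hb K _
  refine ⟨⟨fun K x => ⟨Pt.join
    (f.toFun K ⟨Pt.reindex (relMap V (Fin.castAdd W.m)) x.1, x.2.1⟩ :
      Pt K.toStruc (relIdx V Y'.m))
    (Pt.reindex (relMap V (Fin.natAdd Y.m)) x.1), ?_, ?_⟩, ?_⟩, fun K => ⟨?_, ?_⟩, ?_⟩
  · have hm := Set.mem_of_eq_of_mem (Pt.join_left (f.toFun K ⟨Pt.reindex (relMap V (Fin.castAdd W.m)) x.1, x.2.1⟩).1
      (Pt.reindex (relMap V (Fin.natAdd Y.m)) x.1)) (Subtype.prop _)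
    exact hm
  · have hm := Set.mem_of_eq_of_mem (Pt.join_right _ _ (hbase K x)) (x.2.2)
    exact hm
  · convert (((Y.prod W).set.isDef.reindex
        (W := fun s => relIdx V (Y.m + W.m) s ⊕ relIdx V (Y'.m + W.m) s) (fun s => Sum.inl)).inter
      (f.graph.reindex (W := fun s => relIdx V (Y.m + W.m) s ⊕ relIdx V (Y'.m + W.m) s)
        (fun s => Sum.map (relMap V (Fin.castAdd W.m) s) (relMap V (Fin.castAdd W.m) s)))).inter
      (IsDef.eqTuple (T := T) (V := relIdx V W.m)
        (W := fun s => relIdx V (Y.m + W.m) s ⊕ relIdx V (Y'.m + W.m) s)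
        (fun s i => Sum.inr (relMap V (Fin.natAdd Y'.m) s i))
        (fun s i => Sum.inl (relMap V (Fin.natAdd Y.m) s i))) using 2 with K
    ext p
    constructor
    · rintro ⟨x, rfl⟩
      refine ⟨⟨x.2, ⟨⟨Pt.reindex (relMap V (Fin.castAdd W.m)) x.1, x.2.1⟩, ?_⟩⟩, ?_⟩
      · funext s i
        rcases i with i | i
        · rfl
        · exact congrFun (congrFun (Pt.join_left _ _) s) i
      · exact Pt.join_right _ _ (hbase K x)
    · rintro ⟨⟨h1, ⟨y, hy⟩⟩, h3⟩
      refine ⟨⟨_, h1⟩, ?_⟩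
      have hy1 : y = ⟨Pt.reindex (relMap V (Fin.castAdd W.m)) (p.reindex fun s => Sum.inl),
          h1.1⟩ := by
        refine Subtype.ext ?_
        funext s i
        exact (congrFun (congrFun hy s) (Sum.inl i)).symm
      have hp : p.reindex (fun s => Sum.inr) = Pt.join (f.toFun K y : Pt K.toStruc (relIdx V Y'.m))
          (Pt.reindex (relMap V (Fin.natAdd Y.m)) (p.reindex fun s => Sum.inl)) := by
        refine Pt.ext_join _ _ ?_ ?_
        · rw [Pt.join_left]
          funext s i
          exact congrFun (congrFun hy s) (Sum.inr i)
        · rw [Pt.join_right _ _ (by rw [hy1]; exact hbase K ⟨_, h1⟩)]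
          exact h3
      rw [hy1] at hp
      funext s i
      rcases i with i | i
      · rfl
      · exact congrFun (congrFun hp s) i
  · intro x y hxy
    have h := congrArg Subtype.val hxy
    have hl := congrArg (Pt.reindex (relMap V (Fin.castAdd W.m))) h
    have hr := congrArg (Pt.reindex (relMap V (Fin.natAdd Y'.m))) h
    simp only [Pt.join_left, Pt.join_right _ _ (hbase K _)] at hl hr
    refine Subtype.ext (Pt.ext_join _ _ ?_ hr)
    exact congrArg Subtype.val ((hf K).1 (Subtype.ext hl))
  · intro y
    obtain ⟨x, hx⟩ := (hf K).2 ⟨Pt.reindex (relMap V (Fin.castAdd W.m)) y.1, y.2.1⟩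
    have hxb : Pt.base x.1 = Pt.base (Pt.reindex (relMap V (Fin.natAdd Y'.m)) y.1) := by
      rw [← hb K x, hx]
      rfl
    refine ⟨⟨Pt.join x.1 (Pt.reindex (relMap V (Fin.natAdd Y'.m)) y.1), ?_, ?_⟩, ?_⟩
    · have hm := Set.mem_of_eq_of_mem (Pt.join_left x.1 (Pt.reindex (relMap V (Fin.natAdd Y'.m)) y.1)) (x.2)
      exact hm
    · have hm := Set.mem_of_eq_of_mem (Pt.join_right _ _ hxb) (y.2.2)
      exact hm
    · refine Subtype.ext (Pt.ext_join _ _ ?_ ?_)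
      · simp only [Pt.join_left]
        rw [hx]
      · rw [Pt.join_right _ _ (hbase K _)]
        simp only [Pt.join_right _ _ hxb]
  · intro K x
    exact hb K _

theorem Sym.prod_comm_iso (Y Y' : Sym Z) : (Y.prod Y').Iso (Y'.prod Y) := by
  refine Sym.Iso.of_perm (Y'.prod Y) (Y.prod Y') (finAddFlip (m := Y'.m) (n := Y.m)) fun K x => ?_
  change (_ ∈ Y.set.pts K ∧ _ ∈ Y'.set.pts K) ↔ (_ ∈ Y'.set.pts K ∧ _ ∈ Y.set.pts K)
  simp only [Pt.reindex_relMap]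
  have h1 : (finAddFlip : Fin (Y'.m + Y.m) ≃ _) ∘ Fin.castAdd Y.m = Fin.natAdd Y.m := by
    funext i; simp
  have h2 : (finAddFlip : Fin (Y'.m + Y.m) ≃ _) ∘ Fin.natAdd Y'.m = Fin.castAdd Y'.m := by
    funext i; simp
  rw [h1, h2, and_comm]

theorem Sym.prod_assoc_iso (A B C : Sym Z) : ((A.prod B).prod C).Iso (A.prod (B.prod C)) := by
  refine Sym.Iso.of_perm (A.prod (B.prod C)) ((A.prod B).prod C)
    (finCongr (Nat.add_assoc A.m B.m C.m).symm) fun K x => ?_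
  change ((_ ∈ A.set.pts K ∧ _ ∈ B.set.pts K) ∧ _ ∈ C.set.pts K) ↔
    (_ ∈ A.set.pts K ∧ _ ∈ B.set.pts K ∧ _ ∈ C.set.pts K)
  simp only [Pt.reindex_relMap, and_assoc]
  have h1 : Fin.castAdd C.m ∘ Fin.castAdd B.m =
      finCongr (Nat.add_assoc A.m B.m C.m).symm ∘ Fin.castAdd (B.m + C.m) := by
    funext i; ext; simp
  have h2 : Fin.castAdd C.m ∘ Fin.natAdd A.m =
      (finCongr (Nat.add_assoc A.m B.m C.m).symm ∘ Fin.natAdd A.m) ∘ Fin.castAdd C.m := by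
    funext i; ext; simp
  have h3 : (Fin.natAdd (A.m + B.m) : Fin C.m → _) =
      (finCongr (Nat.add_assoc A.m B.m C.m).symm ∘ Fin.natAdd A.m) ∘ Fin.natAdd B.m := by
    funext i; ext; simp [Nat.add_assoc]
  erw [h1, h2, h3]

theorem Sym.self_prod_iso (Y : Sym Z) : ((Sym.self Z).prod Y).Iso Y := by
  refine Sym.Iso.of_perm Y ((Sym.self Z).prod Y) (finCongr (Nat.zero_add Y.m).symm) fun K x => ?_
  have h : (Fin.natAdd 0 : Fin Y.m → _) = finCongr (Nat.zero_add Y.m).symm := by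
    funext i; ext; simp
  constructor
  · intro hx
    rw [← h]
    exact hx.2
  · intro hx
    rw [← h] at hx
    exact ⟨Y.sub K _ hx, hx⟩

end Isos

section Mul

variable [∀ s, Finite (V s)]

/-- Multiplication on `𝒬₊(Z)`, by the fiber product. -/
noncomputable def Q.mulHom : Q Z →+ Q Z →+ Q Z :=
  Q.lift (fun Y => Q.lift (fun W => (Y.prod W).cls)
      (fun W hW => Sym.cls_empty _ fun K => by
        ext x
        exact ⟨fun hx => by have := hx.2; simp only [DefSet.comap, hW] at this; exact this,
          fun hx => hx.elim⟩)
      (fun W W' hW => by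
        rw [Sym.cls_iso (Sym.prod_comm_iso Y W), Sym.cls_iso (Sym.prod_comm_iso Y W'),
          Sym.cls_iso (hW.prod Y)])
      (fun m W W' hW hW' => by
        have key := Sym.cls_union (Z := Z) _ (Sym.prod Y ⟨m, W, hW⟩).set (Sym.prod Y ⟨m, W', hW'⟩).set
          (Sym.prod Y ⟨m, W, hW⟩).sub (Sym.prod Y ⟨m, W', hW'⟩).sub
        refine Eq.trans ?_ key
        refine congrArg₂ (· + ·) (congrArg _ ?_) (congrArg _ ?_)
        · exact Sym.ext' _ _ fun K => Set.inter_union_distrib_left _ _ _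
        · exact Sym.ext' _ _ fun K => Set.inter_inter_distrib_left _ _ _))
    (fun Y hY => Q.hom_ext fun W => by
      rw [Q.lift_cls]
      refine Sym.cls_empty _ fun K => ?_
      ext x
      exact ⟨fun hx => by have := hx.1; simp only [DefSet.comap, hY] at this; exact this,
          fun hx => hx.elim⟩)
    (fun Y Y' hY => Q.hom_ext fun W => by
      rw [Q.lift_cls, Q.lift_cls]
      exact Sym.cls_iso (hY.prod W))
    (fun m Y Y' hY hY' => Q.hom_ext fun W => by
      rw [AddMonoidHom.add_apply, AddMonoidHom.add_apply, Q.lift_cls, Q.lift_cls, Q.lift_cls,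
        Q.lift_cls]
      have key := Sym.cls_union (Z := Z) _ (Sym.prod ⟨m, Y, hY⟩ W).set (Sym.prod ⟨m, Y', hY'⟩ W).set
          (Sym.prod ⟨m, Y, hY⟩ W).sub (Sym.prod ⟨m, Y', hY'⟩ W).sub
      refine Eq.trans ?_ key
      refine congrArg₂ (· + ·) (congrArg _ ?_) (congrArg _ ?_)
      · exact Sym.ext' _ _ fun K => Set.union_inter_distrib_right _ _ _
      · exact Sym.ext' _ _ fun K => Set.inter_inter_distrib_right _ _ _)

theorem Q.mulHom_cls (Y W : Sym Z) : Q.mulHom Y.cls W.cls = (Y.prod W).cls := by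
  rw [Q.mulHom, Q.lift_cls, Q.lift_cls]

theorem Q.mulHom_comm (a b : Q Z) : Q.mulHom a b = Q.mulHom b a := by
  have : (Q.mulHom : Q Z →+ Q Z →+ Q Z) = Q.mulHom.flip := by
    refine Q.hom_ext fun Y => Q.hom_ext fun W => ?_
    rw [AddMonoidHom.flip_apply, Q.mulHom_cls, Q.mulHom_cls]
    exact Sym.cls_iso (Sym.prod_comm_iso Y W)
  exact congrArg (fun f : Q Z →+ Q Z →+ Q Z => f a b) this

theorem Q.mulHom_assoc (a b c : Q Z) :
    Q.mulHom (Q.mulHom a b) c = Q.mulHom a (Q.mulHom b c) := by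
  have h1 : ∀ A B : Sym Z, (Q.mulHom (Q.mulHom A.cls B.cls) : Q Z →+ Q Z) =
      (Q.mulHom A.cls).comp (Q.mulHom B.cls) := by
    refine fun A B => Q.hom_ext fun C => ?_
    change Q.mulHom (Q.mulHom A.cls B.cls) C.cls = Q.mulHom A.cls (Q.mulHom B.cls C.cls)
    rw [Q.mulHom_cls, Q.mulHom_cls, Q.mulHom_cls, Q.mulHom_cls]
    exact Sym.cls_iso (Sym.prod_assoc_iso A B C)
  have h2 : ∀ (A : Sym Z) (c : Q Z), (Q.mulHom.flip c).comp (Q.mulHom A.cls) =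
      (Q.mulHom A.cls).comp (Q.mulHom.flip c) :=
    fun A c => Q.hom_ext fun B => congrArg (fun f : Q Z →+ Q Z => f c) (h1 A B)
  have h3 : (Q.mulHom.flip c).comp (Q.mulHom.flip b) = Q.mulHom.flip (Q.mulHom b c) :=
    Q.hom_ext fun A => congrArg (fun f : Q Z →+ Q Z => f b) (h2 A c)
  exact congrArg (fun f : Q Z →+ Q Z => f a) h3

theorem Q.mulHom_one (a : Q Z) : Q.mulHom (Sym.self Z).cls a = a := by
  have : Q.mulHom (Sym.self Z).cls = AddMonoidHom.id (Q Z) := by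
    refine Q.hom_ext fun Y => ?_
    rw [Q.mulHom_cls]
    exact Sym.cls_iso (Sym.self_prod_iso Y)
  exact congrArg (fun f : Q Z →+ Q Z => f a) this

noncomputable instance : CommSemiring (Q Z) :=
  { (inferInstance : AddCommMonoid (Q Z)) with
    mul := fun a b => Q.mulHom a b
    one := (Sym.self Z).cls
    mul_comm := Q.mulHom_comm
    mul_assoc := Q.mulHom_assoc
    one_mul := Q.mulHom_one
    mul_one := fun a => (Q.mulHom_comm _ _).trans (Q.mulHom_one a)
    zero_mul := fun a => congrArg (fun f : Q Z →+ Q Z => f a) (map_zero Q.mulHom)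
    mul_zero := fun a => map_zero (Q.mulHom a)
    left_distrib := fun a b c => map_add (Q.mulHom a) b c
    right_distrib := fun a b c => congrArg (fun f : Q Z →+ Q Z => f c) (map_add Q.mulHom a b) }

theorem Sym.cls_mul (Y W : Sym Z) : Y.cls * W.cls = (Y.prod W).cls := Q.mulHom_cls Y W

theorem Sym.cls_self : (Sym.self Z).cls = 1 := rfl

end Mul

/-! ### The morphism `𝒫₊⁰(Z) → 𝒬₊(Z)` -/

theorem isDef_eq_rfZero (i : V RF) :
    IsDef (T := T) (fun K => {x : Pt K.toStruc V | x RF i = K.toStruc.dp0 .rfZero}) := by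
  refine ⟨.eq (.var (Sum.inl i)) (.app (Sum.inl DPFunc.rfZero) fun j => j.elim0), fun K => ?_⟩
  ext x
  simp only [Set.mem_ofPred_eq, Formula.Realize, Formula.Holds, Term.value, Struc.dp0, Pt.append,
    Sum.elim_inl]
  constructor
  · intro hx
    rw [hx]
    exact congrArg _ (funext fun j => j.elim0)
  · intro hx
    rw [hx]
    exact congrArg _ (funext fun j => j.elim0)

variable (Z) in
/-- The definable subset `Z × (k ∖ {0})` of `Z[0,1,0]`, whose class is `𝕃 - 1`. -/
def Sym.Gm : Sym Z where
  m := 1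
  set := ⟨fun K => {x | x.base ∈ Z.pts K} ∩
      {x : Pt K.toStruc (relIdx V 1) | x RF (Sum.inr (0 : Fin 1)) = K.toStruc.dp0 .rfZero}ᶜ,
    (Z.isDef.reindex _).inter (isDef_eq_rfZero _).compl⟩
  sub := fun _ _ hx => hx.1

variable (Z) in
/-- The class of `Y ∩ Z` in `𝒬₊(Z)`. -/
noncomputable def chi (Y : DefSet T V) : Q Z :=
  (Sym.ofSubset Z (Y ∩ Z) fun _ => Set.inter_subset_right).cls

theorem chi_congr {Y Y' : DefSet T V} (hY : ∀ K, Y.pts K ∩ Z.pts K = Y'.pts K ∩ Z.pts K) :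
    chi Z Y = chi Z Y' := by
  refine congrArg Sym.cls (Sym.ext' _ _ fun K => ?_)
  ext x
  exact Set.ext_iff.1 (hY K) _

open MvPolynomial in
variable (Z) in
/-- Evaluation, as functions on `|Z|`, of polynomial expressions in symbols for the characteristic
functions and a symbol for `𝕃 - 1`. -/
noncomputable def evalP : MvPolynomial (Option (DefSet T V)) ℕ →+* (Points Z → ringA) :=
  eval₂Hom (Nat.castRingHom _) (fun o => o.elim (fun _ => LL - 1) charFn)

open Polynomial in
theorem eval_LL_injective :
    Function.Injective (eval₂RingHom (Nat.castRingHom ringA) (LL - 1)) := by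
  have h1 : (algebraMap ℚ[X] (RatFunc ℚ)).comp
      (((taylorAlgHom (-1 : ℚ)) : ℚ[X] →+* ℚ[X]).comp (mapRingHom (Nat.castRingHom ℚ))) =
      ringA.subtype.comp (eval₂RingHom (Nat.castRingHom ringA) (LL - 1)) := by
    refine Polynomial.ringHom_ext' (Subsingleton.elim _ _) ?_
    simp [LL, sub_eq_add_neg]
  have h2 : Function.Injective (ringA.subtype.comp
      (eval₂RingHom (Nat.castRingHom ringA) (LL - 1))) := by
    rw [← h1]
    exact (RatFunc.algebraMap_injective ℚ).comp ((taylor_injective (-1 : ℚ)).comp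
      (map_injective _ Nat.cast_injective))
  exact Function.Injective.of_comp (f := ringA.subtype) h2

theorem exists_evalP_eq (f : PZero Z) : ∃ p, evalP Z p = ((f : PPlus Z) : Points Z → ringA) := by
  obtain ⟨f, hf⟩ := f
  induction hf using Subsemiring.closure_induction with
  | mem f hf =>
    rcases hf with ⟨Y, -, hY⟩ | hf
    · exact ⟨MvPolynomial.X (some Y), by simp [evalP, hY]⟩
    · exact ⟨MvPolynomial.X none, by
        simp only [Set.mem_ofPred_eq] at hf
        simp [evalP, hf]⟩
  | zero => exact ⟨0, by simp⟩
  | one => exact ⟨1, by simp⟩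
  | add f g _ _ hf hg =>
    obtain ⟨p, hp⟩ := hf
    obtain ⟨q, hq⟩ := hg
    exact ⟨p + q, by rw [map_add, hp, hq]; rfl⟩
  | mul f g _ _ hf hg =>
    obtain ⟨p, hp⟩ := hf
    obtain ⟨q, hq⟩ := hg
    exact ⟨p * q, by rw [map_mul, hp, hq]; rfl⟩

section Hom

variable [∀ s, Finite (V s)]

theorem chi_eq_one {Y : DefSet T V} (hY : ∀ K, Z.pts K ⊆ Y.pts K) : chi Z Y = 1 := by
  rw [← Sym.cls_self]
  refine congrArg Sym.cls (Sym.ext' _ _ fun K => ?_)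
  ext x
  exact ⟨fun hx => hx.2, fun hx => ⟨hY K hx, hx⟩⟩

theorem chi_eq_zero {Y : DefSet T V} (hY : ∀ K, Y.pts K ∩ Z.pts K = ∅) : chi Z Y = 0 := by
  refine Sym.cls_empty _ fun K => ?_
  ext x
  exact Set.ext_iff.1 (hY K) _

theorem chi_mul (Y Y' : DefSet T V) : chi Z Y * chi Z Y' = chi Z (Y ∩ Y') := by
  rw [chi, chi, Sym.cls_mul]
  refine congrArg Sym.cls (Sym.ext' _ _ fun K => ?_)
  ext x
  change ((_ ∧ _) ∧ (_ ∧ _)) ↔ ((_ ∧ _) ∧ _)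
  constructor
  · rintro ⟨⟨h1, h2⟩, h3, -⟩
    exact ⟨⟨h1, h3⟩, h2⟩
  · rintro ⟨⟨h1, h3⟩, h2⟩
    exact ⟨⟨h1, h2⟩, h3, h2⟩

/-- The complement of a definable subset. -/
def DefSet.compl (Y : DefSet T V) : DefSet T V := ⟨fun K => (Y.pts K)ᶜ, Y.isDef.compl⟩

theorem chi_add_compl (Y : DefSet T V) : chi Z Y + chi Z Y.compl = 1 := by
  have h := Sym.cls_union (Z := Z) 0 (Sym.ofSubset Z (Y ∩ Z) fun _ => Set.inter_subset_right).set
    (Sym.ofSubset Z (Y.compl ∩ Z) fun _ => Set.inter_subset_right).set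
    (Sym.ofSubset Z (Y ∩ Z) fun _ => Set.inter_subset_right).sub
    (Sym.ofSubset Z (Y.compl ∩ Z) fun _ => Set.inter_subset_right).sub
  refine h.symm.trans ?_
  rw [Sym.cls_empty ⟨0, _ ∩ _, _⟩, add_zero, ← Sym.cls_self]
  · refine congrArg Sym.cls (Sym.ext' _ _ fun K => ?_)
    ext x
    exact ⟨fun hx => hx.elim (fun h => h.2) (fun h => h.2), fun hx =>
      (Classical.em (x.base ∈ Y.pts K)).elim (fun h => Or.inl ⟨h, hx⟩) (fun h => Or.inr ⟨h, hx⟩)⟩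
  · intro K
    ext x
    exact ⟨fun hx => hx.2.1 hx.1.1, fun hx => hx.elim⟩

theorem chi_mul_compl (Y : DefSet T V) : chi Z Y * chi Z Y.compl = 0 := by
  rw [chi_mul]
  refine chi_eq_zero fun K => ?_
  ext x
  exact ⟨fun hx => hx.1.2 hx.1.1, fun hx => hx.elim⟩

theorem chi_mul_self (Y : DefSet T V) : chi Z Y * chi Z Y = chi Z Y := by
  rw [chi_mul]
  refine chi_congr fun K => ?_
  ext x
  exact ⟨fun hx => ⟨hx.1.1, hx.2⟩, fun hx => ⟨⟨hx.1, hx.1⟩, hx.2⟩⟩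

theorem exists_chi_eq_prod (t : Finset (DefSet T V)) : ∃ A : DefSet T V,
    (∀ K x, x ∈ A.pts K ↔ ∀ Y ∈ t, x ∈ Y.pts K) ∧ ∏ Y ∈ t, chi Z Y = chi Z A := by
  classical
  induction t using Finset.induction_on with
  | empty =>
    refine ⟨⟨fun _ => Set.univ, IsDef.univ⟩, fun K x => by simp, ?_⟩
    rw [Finset.prod_empty, chi_eq_one]
    exact fun K => Set.subset_univ _
  | insert Y t hY ih =>
    obtain ⟨A, hA, hA'⟩ := ih
    refine ⟨Y ∩ A, fun K x => ?_, ?_⟩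
    · simp only [Finset.forall_mem_insert, ← hA]
      rfl
    · rw [Finset.prod_insert hY, hA', chi_mul]

open MvPolynomial in
variable (Z) in
/-- Evaluation of the same expressions in `𝒬₊(Z)`. -/
noncomputable def evalQ : MvPolynomial (Option (DefSet T V)) ℕ →+* Q Z :=
  eval₂Hom (Nat.castRingHom _) (fun o => o.elim (Sym.Gm Z).cls (chi Z))

open Polynomial in
theorem evalQ_eq_of_evalP_eq (p p' : MvPolynomial (Option (DefSet T V)) ℕ)
    (h : evalP Z p = evalP Z p') : evalQ Z p = evalQ Z p' := by
  classical
  set S : Finset (DefSet T V) := (p.vars ∪ p'.vars).eraseNone with hS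
  -- specialization of the symbols for characteristic functions to `0` or `1`
  let sp (t : Finset (DefSet T V)) : MvPolynomial (Option (DefSet T V)) ℕ →+* ℕ[X] :=
    MvPolynomial.eval₂Hom C (fun o => o.elim X (fun Y => if Y ∈ t then 1 else 0))
  let valQ : ℕ[X] →+* Q Z := eval₂RingHom (Nat.castRingHom _) (Sym.Gm Z).cls
  -- the class of an atom
  let e (t : Finset (DefSet T V)) : Q Z := (∏ Y ∈ t, chi Z Y) * ∏ Y ∈ S \ t, chi Z Y.compl
  have he : ∑ t ∈ S.powerset, e t = 1 := by
    rw [← Finset.prod_add]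
    exact Finset.prod_eq_one fun Y _ => chi_add_compl Y
  have heq : ∀ t ∈ S.powerset, ∀ Y ∈ S, e t * chi Z Y = e t * (if Y ∈ t then 1 else 0) := by
    intro t ht Y hY
    by_cases hYt : Y ∈ t
    · rw [if_pos hYt, mul_one]
      simp only [e]
      rw [← Finset.mul_prod_erase t _ hYt]
      calc _ = (chi Z Y * chi Z Y) * (∏ x ∈ t.erase Y, chi Z x) *
          ∏ Y ∈ S \ t, chi Z Y.compl := by ring
        _ = _ := by rw [chi_mul_self]
    · rw [if_neg hYt, mul_zero]
      have hY' : Y ∈ S \ t := Finset.mem_sdiff.2 ⟨hY, hYt⟩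
      simp only [e]
      rw [← Finset.mul_prod_erase (S \ t) _ hY']
      calc _ = (∏ x ∈ t, chi Z x) * (chi Z Y * chi Z Y.compl) *
          ∏ Y ∈ (S \ t).erase Y, chi Z Y.compl := by ring
        _ = 0 := by rw [chi_mul_compl, mul_zero, zero_mul]
  have hspec : ∀ t ∈ S.powerset, ∀ q : MvPolynomial (Option (DefSet T V)) ℕ,
      q.vars ⊆ p.vars ∪ p'.vars → e t * evalQ Z q = e t * valQ (sp t q) := by
    intro t ht q hq
    let c : RingCon (Q Z) :=
      { r := fun x y => e t * x = e t * y
        iseqv := ⟨fun _ => rfl, fun h => h.symm, fun h h' => h.trans h'⟩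
        add' := fun {a b c d} h1 h2 => by
          rw [mul_add, mul_add]
          exact congrArg₂ _ h1 h2
        mul' := fun {a b c d} (h1 : e t * a = e t * b) (h2 : e t * c = e t * d) => by
          rw [← mul_assoc, h1, mul_assoc, mul_left_comm, h2, mul_left_comm] }
    have := MvPolynomial.hom_congr_vars (f₁ := c.mk'.comp (evalQ Z))
      (f₂ := c.mk'.comp (valQ.comp (sp t))) (p₁ := q) (p₂ := q) (Subsingleton.elim _ _)
      (fun i hi _ => by
        refine (RingCon.eq c).2 ?_
        rcases i with _ | Y
        · simp [c, evalQ, valQ, sp]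
        · have hYS : Y ∈ S := by
            rw [hS, Finset.mem_eraseNone]
            exact hq hi
          have := heq t ht Y hYS
          change e t * _ = e t * _
          have h2 : (valQ.comp (sp t)) (MvPolynomial.X (some Y)) = if Y ∈ t then 1 else 0 := by
            by_cases hYt : Y ∈ t <;> simp [valQ, sp, hYt]
          rw [h2, ← this]
          simp [evalQ]) rfl
    exact (RingCon.eq c).1 this
  rw [← one_mul (evalQ Z p), ← one_mul (evalQ Z p'), ← he, Finset.sum_mul, Finset.sum_mul]
  refine Finset.sum_congr rfl fun t ht => ?_
  rw [hspec t ht p Finset.subset_union_left, hspec t ht p' Finset.subset_union_right]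
  by_cases hpt : ∃ x : Points Z, (∀ Y ∈ t, x.2.1 ∈ Y.pts x.1) ∧ ∀ Y ∈ S \ t, x.2.1 ∉ Y.pts x.1
  · obtain ⟨x, hx1, hx2⟩ := hpt
    have hval : ∀ q : MvPolynomial (Option (DefSet T V)) ℕ, q.vars ⊆ p.vars ∪ p'.vars →
        evalP Z q x = eval₂RingHom (Nat.castRingHom ringA) (LL - 1) (sp t q) := by
      intro q hq
      exact MvPolynomial.hom_congr_vars
        (f₁ := (Pi.evalRingHom (fun _ : Points Z => ringA) x).comp (evalP Z))
        (f₂ := (eval₂RingHom (Nat.castRingHom ringA) (LL - 1)).comp (sp t)) (p₁ := q) (p₂ := q)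
        (Subsingleton.elim _ _) (fun i hi _ => by
          rcases i with _ | Y
          · simp [evalP, sp]
          · have hYS : Y ∈ S := by
              rw [hS, Finset.mem_eraseNone]
              exact hq hi
            by_cases hYt : Y ∈ t
            · simp [evalP, sp, hYt, charFn, hx1 Y hYt]
            · simp [evalP, sp, hYt, charFn, hx2 Y (Finset.mem_sdiff.2 ⟨hYS, hYt⟩)]) rfl
    have : sp t p = sp t p' := eval_LL_injective (by
      rw [← hval p Finset.subset_union_left, ← hval p' Finset.subset_union_right, h])
    rw [this]
  · have : e t = 0 := by
      obtain ⟨A, hA, hA'⟩ := exists_chi_eq_prod (Z := Z) t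
      obtain ⟨B, hB, hB'⟩ := exists_chi_eq_prod (Z := Z) ((S \ t).image DefSet.compl)
      have hinj : Set.InjOn DefSet.compl ((S \ t : Finset (DefSet T V)) : Set (DefSet T V)) := by
        intro Y _ Y' _ hYY
        refine DefSet.ext (funext fun K => compl_injective ?_)
        exact congrArg (fun X => DefSet.pts X K) hYY
      rw [Finset.prod_image hinj] at hB'
      simp only [e]
      rw [hA', hB', chi_mul]
      refine chi_eq_zero fun K => Set.eq_empty_iff_forall_notMem.2 fun x hx => hpt ?_
      refine ⟨⟨K, x, hx.2⟩, (hA K x).1 hx.1.1, fun Y hY => ?_⟩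
      exact (hB K x).1 hx.1.2 _ (Finset.mem_image_of_mem _ hY)
    rw [this, zero_mul, zero_mul]

variable (Z) in
/-- The semiring morphism `𝒫₊⁰(Z) → 𝒬₊(Z)` sending `𝟏_Y` to `[Y]` and `𝕃 - 1` to `𝕃 - 1`. -/
noncomputable def PZero.toQ : PZero Z →+* Q Z where
  toFun f := evalQ Z (exists_evalP_eq f).choose
  map_zero' := by
    rw [← map_zero (evalQ Z)]
    exact evalQ_eq_of_evalP_eq _ _ (by rw [(exists_evalP_eq _).choose_spec, map_zero]; rfl)
  map_one' := by
    rw [← map_one (evalQ Z)]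
    exact evalQ_eq_of_evalP_eq _ _ (by rw [(exists_evalP_eq _).choose_spec, map_one]; rfl)
  map_add' f g := by
    rw [← map_add (evalQ Z)]
    refine evalQ_eq_of_evalP_eq _ _ ?_
    rw [map_add, (exists_evalP_eq _).choose_spec, (exists_evalP_eq _).choose_spec,
      (exists_evalP_eq _).choose_spec]
    rfl
  map_mul' f g := by
    rw [← map_mul (evalQ Z)]
    refine evalQ_eq_of_evalP_eq _ _ ?_
    rw [map_mul, (exists_evalP_eq _).choose_spec, (exists_evalP_eq _).choose_spec,
      (exists_evalP_eq _).choose_spec]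
    rfl

theorem PZero.toQ_charFn (Y : DefSet T V) (hY : ∀ K, Y.pts K ⊆ Z.pts K) (f : PZero Z)
    (hf : ((f : PPlus Z) : Points Z → ringA) = charFn Y) :
    PZero.toQ Z f = (Sym.ofSubset Z Y hY).cls := by
  have h1 : PZero.toQ Z f = evalQ Z (MvPolynomial.X (some Y)) :=
    evalQ_eq_of_evalP_eq _ _ (by rw [(exists_evalP_eq _).choose_spec, hf]; simp [evalP])
  rw [h1]
  simp only [evalQ, MvPolynomial.eval₂Hom_X', Option.elim]
  refine congrArg Sym.cls (Sym.ext' _ _ fun K => ?_)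
  ext x
  exact ⟨fun hx => hx.1, fun hx => ⟨hx, hY K hx⟩⟩

theorem PZero.toQ_LL (f : PZero Z) (hf : ((f : PPlus Z) : Points Z → ringA) = fun _ => LL - 1) :
    PZero.toQ Z f = (Sym.Gm Z).cls := by
  have h1 : PZero.toQ Z f = evalQ Z (MvPolynomial.X none) :=
    evalQ_eq_of_evalP_eq _ _ (by rw [(exists_evalP_eq _).choose_spec, hf]; simp [evalP])
  rw [h1]
  simp [evalQ]

end Hom

end Q

/-! ## Rational constructible motivic functions -/

section Rational

variable {L : Lang.{u}} {T : Theory L} {V : Srt → Type} [∀ s, Finite (V s)] (Z : DefSet T V)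

/-- The multiplicative set `𝒬₊*(Z)` of classes `[Y → Z]` without empty fibers. -/
noncomputable def QStar : Submonoid (Q Z) where
  carrier := {q | ∃ Y : Sym Z, q = Y.cls ∧
    ∀ (K : TField T), ∀ z ∈ Z.pts K, ∃ y ∈ Y.set.pts K, y.base = z}
  one_mem' := ⟨Sym.self Z, rfl, fun _ z hz =>
    ⟨z.append (fun s (i : hIdx 0 0 0 s) => match s, i with
      | VF, i => Fin.elim0 i
      | RF, i => Fin.elim0 i
      | VG, i => Fin.elim0 i), hz, rfl⟩⟩
  mul_mem' := by
    rintro _ _ ⟨Y, rfl, hY⟩ ⟨W, rfl, hW⟩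
    refine ⟨Y.prod W, Sym.cls_mul Y W, fun K z hz => ?_⟩
    obtain ⟨y, hy, hyz⟩ := hY K z hz
    obtain ⟨w, hw, hwz⟩ := hW K z hz
    have h1 := Set.mem_of_eq_of_mem (Pt.join_left y w) hy
    have h2 := Set.mem_of_eq_of_mem (Pt.join_right y w (hyz.trans hwz.symm)) hw
    exact ⟨y.join w, ⟨h1, h2⟩, hyz⟩

/-- The semiring `𝒬̃₊(Z)`: the localization of `𝒬₊(Z)` at `𝒬₊*(Z)`. -/
abbrev RatQ : Type (u + 1) := Localization (QStar Z)

noncomputable instance : Algebra (PZero Z) (Q Z) := (PZero.toQ Z).toAlgebra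

/-- The semiring `𝒞₊(Z)` of constructible motivic functions. -/
abbrev CPlus : Type (u + 1) := PPlus Z ⊗[PZero Z] Q Z

/-- The semiring `𝒞̃₊(Z)` of rational constructible motivic functions. -/
abbrev RatCPlus : Type (u + 1) := PPlus Z ⊗[PZero Z] RatQ Z

/-- The natural map `𝒞₊(Z) → 𝒞̃₊(Z)`. -/
noncomputable def CPlus.toRat : CPlus Z →+* RatCPlus Z :=
  (Algebra.TensorProduct.map (AlgHom.id (PZero Z) (PPlus Z))
    (IsScalarTower.toAlgHom (PZero Z) (Q Z) (RatQ Z))).toRingHom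

/-- The natural map `𝒬₊(Z) → 𝒞̃₊(Z)`. -/
noncomputable def Q.toRat : Q Z →+* RatCPlus Z :=
  ((Algebra.TensorProduct.includeRight : RatQ Z →ₐ[PZero Z] RatCPlus Z) : RatQ Z →+* RatCPlus Z).comp
    (algebraMap (Q Z) (RatQ Z))

end Rational

/-! ### Pullback from the point `h[0,0,0]` -/

section Point

variable {L : Lang.{u}} {T : Theory L} {V : Srt → Type} (Z : DefSet T V)

/-- The projection of `V × h[0,m,0]` to `h[0,0,0] × h[0,m,0]` on coordinates. -/
def ptMap (V : Srt → Type) (m : ℕ) : ∀ s, relIdx (hIdx 0 0 0) m s → relIdx V m s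
  | VF, .inl i => Fin.elim0 i
  | RF, .inl i => Fin.elim0 i
  | VG, .inl i => Fin.elim0 i
  | _, .inr i => .inr i

/-- The fiber product `Y ⊗_{h[0,0,0]} Z`, that is, `Z × Y` as a definable subset of `Z[0,m,0]`, for
`Y` a definable subset of `h[0,m,0]`. -/
abbrev Sym.overPt (Y : Sym (h T 0 0 0)) : Sym Z where
  m := Y.m
  set := ⟨fun K => {x | x.base ∈ Z.pts K} ∩ {x | x.reindex (ptMap V Y.m) ∈ Y.set.pts K},
    (Z.isDef.reindex _).inter (Y.set.isDef.reindex _)⟩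
  sub := fun _ _ hx => hx.1

/-- The point of `Z × Y` with given components. -/
def Pt.pair {M : Struc L} {m : ℕ} (z : Pt M V) (y : Pt M (relIdx (hIdx 0 0 0) m)) :
    Pt M (relIdx V m)
  | s, .inl i => z s i
  | s, .inr i => y s (.inr i)

theorem Pt.ext_pt {M : Struc L} {m : ℕ} {x y : Pt M (relIdx (hIdx 0 0 0) m)}
    (hxy : ∀ s i, x s (Sum.inr i) = y s (Sum.inr i)) : x = y := by
  funext s i
  rcases i with i | i
  · cases s <;> exact Fin.elim0 i
  · exact hxy s i

theorem Pt.pair_ptMap {M : Struc L} {m : ℕ} (z : Pt M V) (y : Pt M (relIdx (hIdx 0 0 0) m)) :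
    (Pt.pair z y).reindex (ptMap V m) = y :=
  Pt.ext_pt fun s i => by cases s <;> rfl

theorem Pt.ext_pair {M : Struc L} {m : ℕ} {x y : Pt M (relIdx V m)} (h1 : x.base = y.base)
    (h2 : x.reindex (ptMap V m) = y.reindex (ptMap V m)) : x = y := by
  funext s i
  rcases i with i | i
  · exact congrFun (congrFun h1 s) i
  · have := congrFun (congrFun h2 s) (Sum.inr i)
    cases s <;> exact this

variable [∀ s, Finite (V s)]

theorem Sym.Iso.overPt {Y Y' : Sym (h T 0 0 0)} (hY : Y.Iso Y') :
    (Y.overPt Z).Iso (Y'.overPt Z) := by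
  obtain ⟨f, hf, -⟩ := hY
  refine ⟨⟨fun K x => ⟨Pt.pair (Pt.base x.1) (f.toFun K ⟨Pt.reindex (ptMap V Y.m) x.1, x.2.2⟩).1,
    x.2.1, ?_⟩, ?_⟩, fun K => ⟨?_, ?_⟩, ?_⟩
  · have hm := Set.mem_of_eq_of_mem (Pt.pair_ptMap (Pt.base x.1)
      (f.toFun K ⟨Pt.reindex (ptMap V Y.m) x.1, x.2.2⟩).1) (Subtype.prop _)
    exact hm
  · convert (((Y.overPt Z).set.isDef.reindex
        (W := fun s => relIdx V Y.m s ⊕ relIdx V Y'.m s) (fun s => Sum.inl)).inter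
      (f.graph.reindex (W := fun s => relIdx V Y.m s ⊕ relIdx V Y'.m s)
        (fun s => Sum.map (ptMap V Y.m s) (ptMap V Y'.m s)))).inter
      (IsDef.eqTuple (T := T) (V := V) (W := fun s => relIdx V Y.m s ⊕ relIdx V Y'.m s)
        (fun s i => Sum.inr (Sum.inl i)) (fun s i => Sum.inl (Sum.inl i))) using 2 with K
    ext p
    constructor
    · rintro ⟨x, rfl⟩
      refine ⟨⟨x.2, ⟨⟨Pt.reindex (ptMap V Y.m) x.1, x.2.2⟩, ?_⟩⟩, rfl⟩
      funext s i
      rcases i with i | i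
      · rfl
      · exact congrFun (congrFun (Pt.pair_ptMap _ _) s) i
    · rintro ⟨⟨h1, ⟨y, hy⟩⟩, h3⟩
      refine ⟨⟨_, h1⟩, ?_⟩
      have hy1 : y = ⟨Pt.reindex (ptMap V Y.m) (p.reindex fun s => Sum.inl), h1.2⟩ := by
        refine Subtype.ext ?_
        funext s i
        exact (congrFun (congrFun hy s) (Sum.inl i)).symm
      have hp : p.reindex (fun s => Sum.inr) = Pt.pair (Pt.base (p.reindex fun s => Sum.inl))
          (f.toFun K y : Pt K.toStruc (relIdx (hIdx 0 0 0) Y'.m)) := by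
        refine Pt.ext_pair h3 ?_
        rw [Pt.pair_ptMap]
        funext s i
        exact congrFun (congrFun hy s) (Sum.inr i)
      rw [hy1] at hp
      funext s i
      rcases i with i | i
      · rfl
      · exact congrFun (congrFun hp s) i
  · intro x y hxy
    have h := congrArg Subtype.val hxy
    have hl := congrArg Pt.base h
    have hr := congrArg (Pt.reindex (ptMap V Y'.m)) h
    simp only [Pt.pair_ptMap] at hr
    refine Subtype.ext (Pt.ext_pair hl ?_)
    exact congrArg Subtype.val ((hf K).1 (Subtype.ext hr))
  · intro y
    obtain ⟨x, hx⟩ := (hf K).2 ⟨Pt.reindex (ptMap V Y'.m) y.1, y.2.2⟩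
    refine ⟨⟨Pt.pair (Pt.base y.1) x.1, y.2.1, ?_⟩, ?_⟩
    · have hm := Set.mem_of_eq_of_mem (Pt.pair_ptMap (Pt.base y.1) x.1) x.2
      exact hm
    · refine Subtype.ext (Pt.ext_pair rfl ?_)
      simp only [Pt.pair_ptMap]
      rw [hx]
  · intro K x
    rfl

/-- The additive map underlying `Q.ofPt`. -/
noncomputable def Q.ofPtAdd : Q (h T 0 0 0) →+ Q Z :=
  Q.lift (fun Y => (Y.overPt Z).cls)
    (fun Y hY => Sym.cls_empty _ fun K => by
      ext x
      exact ⟨fun hx => by have := hx.2; simp only [hY] at this; exact this, fun hx => hx.elim⟩)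
    (fun Y Y' hY => Sym.cls_iso (hY.overPt Z))
    (fun m Y Y' hY hY' => by
      have key := Sym.cls_union (Z := Z) _ (Sym.overPt Z ⟨m, Y, hY⟩).set
        (Sym.overPt Z ⟨m, Y', hY'⟩).set (Sym.overPt Z ⟨m, Y, hY⟩).sub
        (Sym.overPt Z ⟨m, Y', hY'⟩).sub
      refine Eq.trans ?_ key
      refine congrArg₂ (· + ·) (congrArg _ ?_) (congrArg _ ?_)
      · exact Sym.ext' _ _ fun K => Set.inter_union_distrib_left _ _ _
      · exact Sym.ext' _ _ fun K => Set.inter_inter_distrib_left _ _ _)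

theorem Q.ofPtAdd_cls (Y : Sym (h T 0 0 0)) : Q.ofPtAdd Z Y.cls = (Y.overPt Z).cls :=
  Q.lift_cls _ _ _ _ Y

/-- The pullback `𝒬₊(h[0,0,0]) → 𝒬₊(Z)` along `Z → h[0,0,0]`, sending `[Y]` to
`[Y ⊗_{h[0,0,0]} Z]`. -/
noncomputable def Q.ofPt : Q (h T 0 0 0) →+* Q Z :=
  { Q.ofPtAdd Z with
    map_one' := by
      change Q.ofPtAdd Z 1 = 1
      rw [← Sym.cls_self, ← Sym.cls_self, Q.ofPtAdd_cls]
      refine congrArg Sym.cls (Sym.ext' _ _ fun K => ?_)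
      ext x
      exact ⟨fun hx => hx.1, fun hx => ⟨hx, trivial⟩⟩
    map_mul' := fun a b => by
      change Q.ofPtAdd Z (a * b) = Q.ofPtAdd Z a * Q.ofPtAdd Z b
      set f := Q.ofPtAdd Z with hf
      have hgen : ∀ Y W : Sym (h T 0 0 0), f (Y.cls * W.cls) = f Y.cls * f W.cls := by
        intro Y W
        rw [Sym.cls_mul, hf, Q.ofPtAdd_cls, Q.ofPtAdd_cls, Q.ofPtAdd_cls, Sym.cls_mul]
        refine congrArg Sym.cls (Sym.ext' _ _ fun K => ?_)
        ext x
        have e1 : (x.reindex (relMap V (Fin.castAdd W.m))).reindex (ptMap V Y.m) =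
            (x.reindex (ptMap V (Y.m + W.m))).reindex (relMap _ (Fin.castAdd W.m)) :=
          Pt.ext_pt fun s i => by cases s <;> rfl
        have e2 : (x.reindex (relMap V (Fin.natAdd Y.m))).reindex (ptMap V W.m) =
            (x.reindex (ptMap V (Y.m + W.m))).reindex (relMap _ (Fin.natAdd Y.m)) :=
          Pt.ext_pt fun s i => by cases s <;> rfl
        constructor
        · rintro ⟨h1, h2, h3⟩
          exact ⟨⟨h1, Eq.mpr (congrArg (· ∈ Y.set.pts K) e1) h2⟩, h1, Eq.mpr (congrArg (· ∈ W.set.pts K) e2) h3⟩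
        · rintro ⟨⟨h1, h2⟩, -, h3⟩
          exact ⟨h1, Eq.mp (congrArg (· ∈ Y.set.pts K) e1) h2, Eq.mp (congrArg (· ∈ W.set.pts K) e2) h3⟩
      have h1 : ∀ Y : Sym (h T 0 0 0), f.comp (AddMonoidHom.mulLeft Y.cls) =
          (AddMonoidHom.mulLeft (f Y.cls)).comp f := fun Y => Q.hom_ext (hgen Y)
      have h2 : f.comp (AddMonoidHom.mulRight b) = (AddMonoidHom.mulRight (f b)).comp f :=
        Q.hom_ext fun Y => congrArg (fun g : Q (h T 0 0 0) →+ Q Z => g b) (h1 Y)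
      exact congrArg (fun g : Q (h T 0 0 0) →+ Q Z => g a) h2 }

theorem Q.ofPt_cls (Y : Sym (h T 0 0 0)) : Q.ofPt Z Y.cls = (Y.overPt Z).cls :=
  Q.ofPtAdd_cls Z Y

end Point

end RatMot

namespace RatMot

open Srt
open scoped TensorProduct

/-! ## Ultraproducts -/

section Ultraproduct

variable {L : Lang.{u}} {I : Type u} (U : Ultrafilter I) (M : I → Struc L) {V W : Srt → Type}

/-! A denominator of `F` is the class of a definable family `W` over `ℤ^r` of nonempty subsets of
`k^m`. The point is that this family is piecewise constant: there is a finite definable partition of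
`ℤ^r` into parts `A_k` such that, in every `T`-field, the fiber of `W` over `z` depends only on the
part containing `z` (`IsSplit.exists_partition_fiber`). The intersection `Y_k` of the fibers over
`A_k` is definable over the point, since it is obtained by quantifying over `z`, and `𝟏_{A_k} [W] =
𝟏_{A_k} [Y_k]`. Moreover `Y_k(K)` is never empty: it is a fiber of `W` if `A_k(K) ≠ ∅`, and all of
`k_K^m` otherwise.

Let `Y` be the product of the `Y_k` and `t = ∑_k 𝟏_{A_k} ∏_{j ≠ k} [Y_j]`. Then `t [W]` is the
pullback of `[Y]` (`IsSplit.exists_mul_eq_ofPt`). As every multiple of a denominator clears it as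
well (`exists_map_eq_mul`), `[Y]` clears the denominators of `F`.

The difficulty is uniformity. Splitness cuts `W` into rectangles in each model separately, and the
rectangles may vary with the model. Within one model they show that the fiber over `z` is determined
by the type of `z` over `∅` (`IsSplit.realize_of_forall_iff`). Compactness then yields finitely many
formulas that determine the fiber in all models at once (`IsSplit.exists_finset_formula`): otherwise
each finite set of formulas has a counterexample in some model, and an ultraproduct of these models
contains two points of the same type with different fibers. The value group of that ultraproduct
need not be `ℤ`, so it matters that splitness is assumed in all models of `T`, not only in the
`T`-fields. -/

/-- The ultraproduct of a family of structures. -/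
noncomputable def Struc.ultraproduct : Struc L where
  carrier s := (U : Filter I).Product (fun i => (M i).carrier s)
  func f ts := Quotient.mk _ fun i => (M i).func f fun j => Quotient.out (ts j) i
  rel R ts := ∀ᶠ i in U, (M i).rel R fun j => Quotient.out (ts j) i

variable {M}

/-- The point of an ultraproduct represented by a family of points. -/
def Pt.ultra (x : ∀ i, Pt (M i) V) : Pt (Struc.ultraproduct U M) V :=
  fun s v => Quotient.mk _ fun i => x i s v

theorem Pt.ultra_append (x : ∀ i, Pt (M i) V) (y : ∀ i, Pt (M i) W) :
    (Pt.ultra U x).append (Pt.ultra U y) = Pt.ultra U fun i => (x i).append (y i) := by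
  funext s v
  cases v <;> rfl

theorem Pt.ultra_cons {Γ : List Srt} {t : Srt} (a : ∀ i, (M i).carrier t)
    (e : ∀ i, Pt (M i) (BVar Γ)) :
    Pt.cons (M := Struc.ultraproduct U M) (Quotient.mk _ a) (Pt.ultra U e) =
      Pt.ultra U fun i => Pt.cons (a i) (e i) := by
  funext s v
  cases v <;> rfl

/-- Symbols are interpreted in the ultraproduct through chosen representatives. A symbol has
finitely many arguments, so the chosen representatives agree with any given ones simultaneously on a
set in `U`, and the choice does not matter. -/
theorem eventually_out_eq {a : List Srt} (f : ∀ j : Fin a.length, ∀ i, (M i).carrier (a.get j)) :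
    ∀ᶠ i in U, (fun j => Quotient.out (s := (U : Filter I).productSetoid
      fun i => (M i).carrier (a.get j)) (Quotient.mk _ (f j)) i) = fun j => f j i := by
  have h : ∀ j, ∀ᶠ i in U, Quotient.out (s := (U : Filter I).productSetoid
      fun i => (M i).carrier (a.get j)) (Quotient.mk _ (f j)) i = f j i :=
    fun j => Quotient.mk_out (s := (U : Filter I).productSetoid _) (f j)
  filter_upwards [Filter.eventually_all.2 h] with i hi
  exact funext hi

theorem Term.value_ultra (x : ∀ i, Pt (M i) V) {s : Srt} (t : Term L V s) :
    t.value (Pt.ultra U x) = Quotient.mk _ fun i => t.value (x i) := by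
  induction t with
  | var v => rfl
  | app f ts ih =>
    simp only [Term.value, ih]
    refine Quotient.sound ?_
    filter_upwards [eventually_out_eq U fun j i => (ts j).value (x i)] with i hi
    exact congrArg _ hi

/-- Łoś's theorem. -/
theorem Formula.holds_ultra (hne : ∀ i s, Nonempty ((M i).carrier s)) (x : ∀ i, Pt (M i) V)
    {Γ : List Srt} (φ : Formula L V Γ) : ∀ e : ∀ i, Pt (M i) (BVar Γ),
      φ.Holds (Pt.ultra U x) (Pt.ultra U e) ↔ ∀ᶠ i in U, φ.Holds (x i) (e i) := by
  induction φ with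
  | falsum => exact fun e => Filter.eventually_const.symm
  | eq t t' =>
    intro e
    simp only [Formula.Holds, Pt.ultra_append, Term.value_ultra]
    exact Quotient.eq
  | rel R ts =>
    intro e
    simp only [Formula.Holds, Pt.ultra_append, Term.value_ultra]
    refine Filter.eventually_congr ?_
    filter_upwards [eventually_out_eq U fun j i => (ts j).value ((x i).append (e i))] with i hi
    exact iff_of_eq (congrArg _ hi)
  | imp φ ψ h1 h2 =>
    intro e
    simp only [Formula.Holds, h1, h2]
    exact Ultrafilter.eventually_imp.symm
  | all s φ h =>
    intro e
    simp only [Formula.Holds]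
    constructor
    · intro H
      by_contra hc
      rw [← Ultrafilter.eventually_not] at hc
      -- A counterexample is chosen wherever there is one, and an arbitrary element elsewhere; this
      -- is where nonempty sorts are needed. The class of this family refutes the universal
      -- statement in the ultraproduct.
      have : ∀ i, ∃ a, (¬ ∀ a, φ.Holds (x i) (Pt.cons a (e i))) →
          ¬ φ.Holds (x i) (Pt.cons a (e i)) := fun i => by
        by_cases hi : ∀ a, φ.Holds (x i) (Pt.cons a (e i))
        · exact ⟨(hne i s).some, fun h => (h hi).elim⟩
        · obtain ⟨a, ha⟩ := not_forall.1 hi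
          exact ⟨a, fun _ => ha⟩
      choose a ha using this
      have H1 := H (Quotient.mk _ a)
      rw [Pt.ultra_cons, h] at H1
      obtain ⟨i, hi, hi'⟩ := (H1.and hc).exists
      exact ha i hi' hi
    · intro H a
      obtain ⟨a, rfl⟩ := Quotient.exists_rep a
      rw [Pt.ultra_cons, h]
      filter_upwards [H] with i hi
      exact hi _

theorem Formula.realize_ultra (hne : ∀ i s, Nonempty ((M i).carrier s)) (x : ∀ i, Pt (M i) V)
    (φ : Formula L V []) : φ.Realize (Pt.ultra U x) ↔ ∀ᶠ i in U, φ.Realize (x i) := by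
  have : (emptyEnv : Pt (Struc.ultraproduct U M) (BVar [])) = Pt.ultra U fun _ => emptyEnv := by
    funext s v
    exact nomatch v
  rw [Formula.Realize, this, φ.holds_ultra U hne x]
  rfl

theorem Struc.ultraproduct_isModel {T : Theory L} (hne : ∀ i s, Nonempty ((M i).carrier s))
    (hM : ∀ i, (M i).IsModel T) : (Struc.ultraproduct U M).IsModel T := by
  intro σ hσ
  have h := (σ.realize_ultra U hne fun i (_ : Srt) (v : Empty) => v.elim).2
    (Filter.Eventually.of_forall fun i => hM i σ hσ)
  convert h using 2

end Ultraproduct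

/-! ## Universal quantification over tuples -/

section Quantifiers

variable {L : Lang.{u}} {T : Theory L} {M : Struc L} {V W : Srt → Type}

/-- Extension of a renaming of free and bound variables under a quantifier. -/
def liftBound {Γ Δ : List Srt} (t : Srt) (ρ : ∀ s, V s ⊕ BVar Γ s → W s ⊕ BVar Δ s) :
    ∀ s, V s ⊕ BVar (t :: Γ) s → W s ⊕ BVar (t :: Δ) s
  | s, .inl v => Sum.map id .succ (ρ s (.inl v))
  | _, .inr .zero => .inr .zero
  | s, .inr (.succ b) => Sum.map id .succ (ρ s (.inr b))

/-- Renaming of free and bound variables, where free variables may become bound. -/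
def Formula.renameBound : ∀ {Γ Δ : List Srt}, (∀ s, V s ⊕ BVar Γ s → W s ⊕ BVar Δ s) →
    Formula L V Γ → Formula L W Δ
  | _, _, _, .falsum => .falsum
  | _, _, ρ, .eq t t' => .eq (t.rename ρ) (t'.rename ρ)
  | _, _, ρ, .rel R ts => .rel R fun i => (ts i).rename ρ
  | _, _, ρ, .imp φ ψ => .imp (φ.renameBound ρ) (ψ.renameBound ρ)
  | _, _, ρ, .all s φ => .all s (φ.renameBound (liftBound s ρ))

/-- Free variables may turn into bound ones, so the two assignments cannot be compared separately on
each kind; `h` compares the concatenated assignments. Under a quantifier `liftBound` fixes the new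
variable and shifts the bound variables among the images, which preserves `h`. -/
theorem Formula.holds_renameBound {Γ : List Srt} (φ : Formula L V Γ) {Δ : List Srt}
    (ρ : ∀ s, V s ⊕ BVar Γ s → W s ⊕ BVar Δ s) (x : Pt M V) (e : Pt M (BVar Γ)) (x' : Pt M W)
    (e' : Pt M (BVar Δ)) (h : (x'.append e').reindex ρ = x.append e) :
    (φ.renameBound ρ).Holds x' e' ↔ φ.Holds x e := by
  induction φ generalizing Δ with
  | falsum => rfl
  | eq t t' => simp only [Formula.renameBound, Formula.Holds, Term.value_rename, h]
  | rel R ts => simp only [Formula.renameBound, Formula.Holds, Term.value_rename, h]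
  | imp φ ψ h1 h2 =>
    simp only [Formula.renameBound, Formula.Holds, h1 ρ e e' h, h2 ρ e e' h]
  | all s φ ih =>
    simp only [Formula.renameBound, Formula.Holds]
    refine forall_congr' fun a => ih _ _ _ ?_
    have hsucc : ∀ t (w : W t ⊕ BVar _ t), (x'.append (Pt.cons a e')) t (Sum.map id .succ w) =
        x'.append e' t w := by
      intro t w
      cases w <;> rfl
    funext t v
    rcases v with v | v
    · exact (hsucc t _).trans (congrFun (congrFun h t) (Sum.inl v))
    · cases v with
      | zero => rfl
      | succ b => exact (hsucc t _).trans (congrFun (congrFun h t) (Sum.inr b))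

/-- Universal quantification over all bound variables in scope. -/
def Formula.allBound : ∀ {Γ : List Srt}, Formula L V Γ → Formula L V []
  | [], φ => φ
  | s :: _, φ => (Formula.all s φ).allBound

theorem Formula.realize_allBound (x : Pt M V) : ∀ {Γ : List Srt} (φ : Formula L V Γ),
    φ.allBound.Realize x ↔ ∀ e : Pt M (BVar Γ), φ.Holds x e
  | [], φ => by
    refine ⟨fun hφ e => ?_, fun hφ => hφ _⟩
    have : e = emptyEnv := by
      funext s v
      exact nomatch v
    rw [this]
    exact hφ
  | s :: Γ, φ => by
    rw [Formula.allBound, Formula.realize_allBound x]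
    refine ⟨fun hφ e => ?_, fun hφ e a => hφ _⟩
    convert hφ (fun t v => e t v.succ) (e s .zero) using 1
    funext t v
    cases v <;> rfl

/-- The variables of a block of bound variables of the same sort. -/
def BVar.ofFin (s : Srt) : ∀ {r : ℕ}, Fin r → BVar (List.replicate r s) s
  | 0 => fun i => i.elim0
  | _ + 1 => Fin.cases .zero fun i => (BVar.ofFin s i).succ

/-- Quantifying over the environments of a block of `r` variables thus amounts to quantifying over
all `r`-tuples. -/
theorem BVar.exists_env [∀ s, Nonempty (M.carrier s)] (s : Srt) : ∀ {r : ℕ}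
    (f : Fin r → M.carrier s),
    ∃ e : Pt M (BVar (List.replicate r s)), ∀ i, e s (BVar.ofFin s i) = f i
  | 0, _ => ⟨emptyEnv, fun i => i.elim0⟩
  | _ + 1, f => by
    obtain ⟨e, he⟩ := BVar.exists_env s fun i => f i.succ
    refine ⟨Pt.cons (f 0) e, fun i => ?_⟩
    refine Fin.cases ?_ (fun i => ?_) i
    · rfl
    · exact he i

/-- The renaming that binds `r` variables of sort `VG`. -/
def bindVG (V : Srt → Type) (r : ℕ) : ∀ s, (V s ⊕ hIdx 0 0 r s) ⊕ BVar [] s →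
    V s ⊕ BVar (List.replicate r VG) s
  | _, .inl (.inl v) => .inl v
  | VF, .inl (.inr i) => Fin.elim0 i
  | RF, .inl (.inr i) => Fin.elim0 i
  | VG, .inl (.inr i) => .inr (BVar.ofFin VG i)

/-- The `r` coordinates of sort `VG` are turned into bound variables by `bindVG`, and the resulting
formula is closed universally. This makes the common fiber of a family over a part of `ℤ^r`
definable. -/
theorem IsDef.forallVG (hne : ∀ (K : TField T) s, Nonempty (K.carrier s)) {r : ℕ}
    {X : ∀ K : TField T, Set (Pt K.toStruc fun s => V s ⊕ hIdx 0 0 r s)} (hX : IsDef X) :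
    IsDef (fun K => {x : Pt K.toStruc V | ∀ z : Pt K.toStruc (hIdx 0 0 r), x.append z ∈ X K}) := by
  obtain ⟨φ, hφ⟩ := hX
  refine ⟨(φ.renameBound (bindVG V r)).allBound, fun K => ?_⟩
  have := hne K
  ext x
  simp only [Set.mem_ofPred_eq, hφ, Formula.realize_allBound]
  have key : ∀ (z : Pt K.toStruc (hIdx 0 0 r)) (e : Pt K.toStruc (BVar (List.replicate r VG))),
      (∀ i : Fin r, e VG (BVar.ofFin VG i) = z VG i) →
      ((φ.renameBound (bindVG V r)).Holds x e ↔ φ.Realize (x.append z)) := by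
    intro z e hz
    refine φ.holds_renameBound _ _ _ _ _ ?_
    funext s v
    rcases v with (v | v) | v
    · rfl
    · cases s
      · exact Fin.elim0 v
      · exact Fin.elim0 v
      · exact hz v
    · exact nomatch v
  constructor
  · intro H e
    -- The tuple `z` is read off from the environment `e`.
    exact (key (fun s i => match s, i with
      | VF, i => Fin.elim0 i
      | RF, i => Fin.elim0 i
      | VG, i => e VG (BVar.ofFin VG i)) e fun _ => rfl).2 (H _)
  · intro H z
    obtain ⟨e, he⟩ := BVar.exists_env VG fun i => z VG i
    exact (key z e he).1 (H e)

end Quantifiers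

/-! ## Uniform separation of residue field and value group variables -/

section Separation

variable {L : Lang.{u}} {T : Theory L} {V : Srt → Type}

/-- Łoś's theorem requires nonempty sorts. The sort `VG` has no constant in the language of
Denef-Pas, so an element is produced by `ord`. -/
theorem Struc.IsHenselianAC0.nonempty {M : Struc L} (hM : M.IsHenselianAC0) (s : Srt) :
    Nonempty (M.carrier s) := by
  obtain ⟨_, _, _, -⟩ := hM
  cases s
  · exact ⟨M.dp0 .vfZero⟩
  · exact ⟨M.dp0 .rfZero⟩
  · exact ⟨M.dp1 .ord (M.dp0 .vfZero)⟩

/-- A parameter would be an element of `∅`, so the formula has no parameter variables and their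
renaming is vacuous. -/
theorem Struc.DefinableOver.exists_formula {M : Struc L} {X : Set (Pt M V)}
    (hX : M.DefinableOver (fun _ => ∅) X) : ∃ ψ : Formula L V [], X = {x | ψ.Realize x} := by
  obtain ⟨n, m, r, c, φ, hc, rfl⟩ := hX
  refine ⟨φ.rename fun s => Sum.elim id fun i => (hc s i).elim, ?_⟩
  ext x
  simp only [Set.mem_ofPred_eq, Formula.Realize, Formula.holds_rename]
  have : x.reindex (fun s => Sum.elim id fun i => (hc s i).elim) = x.append c := by
    funext s v
    rcases v with v | v
    · rfl
    · exact (hc s v).elim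
  rw [this]

/-- The coordinates of `h[0,0,r][0,m,0]` among those of `h[0,m,r]`. -/
def relToH (m r : ℕ) : ∀ s, relIdx (hIdx 0 0 r) m s → hIdx 0 m r s
  | VF, .inl i => i
  | VF, .inr i => i
  | RF, .inl i => Fin.elim0 i
  | RF, .inr i => i
  | VG, .inl i => i
  | VG, .inr i => Fin.elim0 i

/-- The point of `h[0,m,r]` with given components. -/
def Pt.ofPair {M : Struc L} {m r : ℕ} (x : Fin m → M.carrier RF) (z : Fin r → M.carrier VG) :
    Pt M (hIdx 0 m r)
  | VF => fun i => Fin.elim0 i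
  | RF => x
  | VG => z

theorem Pt.ofPair_eta {M : Struc L} {m r : ℕ} (x : Pt M (hIdx 0 m r)) :
    Pt.ofPair (x RF) (x VG) = x := by
  funext s i
  cases s
  · exact Fin.elim0 i
  · rfl
  · rfl

theorem Pt.reindex_ofPair {M : Struc L} {m r : ℕ} (z : Pt M (hIdx 0 0 r)) (x : Pt M (hIdx 0 m 0)) :
    (Pt.ofPair (x RF) (z VG)).reindex (relToH m r) = z.append x := by
  funext s i
  cases s <;> rcases i with i | i
  · exact Fin.elim0 i
  · exact Fin.elim0 i
  · exact Fin.elim0 i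
  · rfl
  · rfl
  · exact Fin.elim0 i

/-- In a model of a split theory, the fibers over `Γ^r` of a subset of `k^m × Γ^r` definable
without parameters only depend on the type of the base point. -/
theorem IsSplit.realize_of_forall_iff (hsplit : IsSplit T) {m r : ℕ}
    (θ : Formula L (relIdx (hIdx 0 0 r) m) []) {M : Struc L} (hM : M.IsModel T)
    {z z' : Pt M (hIdx 0 0 r)} (x : Pt M (hIdx 0 m 0))
    (hz : ∀ ψ : Formula L (hIdx 0 0 r) [], ψ.Realize z ↔ ψ.Realize z')
    (hθ : θ.Realize (z.append x)) : θ.Realize (z'.append x) := by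
  -- The subset of `k^m × Γ^r` cut out by `θ`, with the residue field factor first as in the
  -- definition of split theories.
  let X : Set ((Fin m → M.carrier RF) × (Fin r → M.carrier VG)) :=
    {p | θ.Realize ((Pt.ofPair p.1 p.2).reindex (relToH m r))}
  have hX : M.DefinableOver (fun _ => ∅) (rfvgSet X) := by
    have hemp : ∀ s, IsEmpty (hIdx 0 0 0 s) := fun s => by
      cases s <;> exact inferInstanceAs (IsEmpty (Fin 0))
    refine ⟨0, 0, 0, fun s i => (hemp s).elim i,
      θ.rename fun s i => Sum.inl (relToH m r s i), fun s i => (hemp s).elim i, ?_⟩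
    ext y
    change θ.Realize ((Pt.ofPair (y RF) (y VG)).reindex (relToH m r)) ↔ _
    rw [Pt.ofPair_eta, Set.mem_ofPred_eq, Formula.Realize, Formula.Realize, Formula.holds_rename]
    rfl
  obtain ⟨N, Y, Z, -, hZ, -, hXYZ⟩ := hsplit.orthogonal M hM (fun _ => ∅)
    (fun _ => Set.finite_empty) m r X hX
  have hmem : (x RF, z VG) ∈ X := by
    change θ.Realize _
    rw [Pt.reindex_ofPair]
    exact hθ
  -- The point lies in a rectangle `Y i ×ˢ Z i`. Since `Z i` is defined without parameters and `z'`
  -- has the same type as `z`, also `z' ∈ Z i`, so `(x, z')` lies in the same rectangle.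
  obtain ⟨i, hxi, hzi⟩ := Set.mem_iUnion.1 (hXYZ.subset hmem)
  obtain ⟨ψ, hψ⟩ := (hZ i).exists_formula
  have hzψ : z ∈ vgSet (Z i) := hzi
  have hzψ' : z' ∈ vgSet (Z i) := by
    rw [hψ] at hzψ ⊢
    exact (hz ψ).1 hzψ
  have hmem' : (x RF, z' VG) ∈ X := by
    exact hXYZ.superset (Set.mem_iUnion.2 ⟨i, hxi, hzψ'⟩)
  rw [← Pt.reindex_ofPair]
  exact hmem'

/-- Finitely many formulas in the value group variables decide the fibers of a definable subset of
`k^m × Γ^r`, uniformly in all models of a split theory. -/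
theorem IsSplit.exists_finset_formula (hsplit : IsSplit T)
    (hne : ∀ M : Struc L, M.IsModel T → ∀ s, Nonempty (M.carrier s)) {m r : ℕ}
    (θ : Formula L (relIdx (hIdx 0 0 r) m) []) :
    ∃ S : Finset (Formula L (hIdx 0 0 r) []), ∀ M : Struc L, M.IsModel T →
      ∀ (z z' : Pt M (hIdx 0 0 r)) (x : Pt M (hIdx 0 m 0)),
        (∀ ψ ∈ S, ψ.Realize z ↔ ψ.Realize z') → θ.Realize (z.append x) →
          θ.Realize (z'.append x) := by
  classical
  -- Each finite set `S` of formulas now has a model with points `z`, `z'` that agree on `S`, and a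
  -- point `x` in the fiber over `z` but not in the one over `z'`.
  by_contra! H
  choose M hM z z' x hz hθ hθ' using H
  -- The index set consists of the finite sets of formulas, and `U` contains each cone `{S | ψ ∈
  -- S}`. Hence `z` and `z'` become points of the same type in the ultraproduct.
  let U : Ultrafilter (Finset (Formula L (hIdx 0 0 r) [])) := Ultrafilter.of Filter.atTop
  have hne' : ∀ S s, Nonempty ((M S).carrier s) := fun S => hne _ (hM S)
  have h := hsplit.realize_of_forall_iff θ (Struc.ultraproduct_isModel U hne' hM)
    (z := Pt.ultra U z) (z' := Pt.ultra U z') (Pt.ultra U x)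
    (fun ψ => by
      rw [Formula.realize_ultra U hne', Formula.realize_ultra U hne']
      refine Filter.eventually_congr ?_
      filter_upwards [Ultrafilter.of_le _ (Filter.eventually_ge_atTop {ψ})] with S hS
      exact hz S ψ (hS (Finset.mem_singleton_self ψ)))
    (by
      rw [Pt.ultra_append, Formula.realize_ultra U hne']
      exact Filter.Eventually.of_forall hθ)
  rw [Pt.ultra_append, Formula.realize_ultra U hne'] at h
  obtain ⟨S, hS⟩ := h.exists
  exact hθ' S hS

end Separation

/-! ## Clearing denominators -/

section Denominators

variable {L : Lang.{u}} {T : Theory L}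

/-! ### Finite definable partitions and common fibers -/

/-- A finite family of definable subsets has a finite definable partition refining it. -/
theorem exists_partition {V : Srt → Type} [∀ s, Finite (V s)] (Z : DefSet T V) {ι : Type*}
    (D : ι → DefSet T V) (S : Finset ι) :
    ∃ (κ : Type) (_ : Fintype κ) (A : κ → DefSet T V), ∑ k, chi Z (A k) = 1 ∧
      ∀ k, ∀ j ∈ S, ∀ (K : TField T), ∀ x ∈ (A k).pts K, ∀ x' ∈ (A k).pts K,
        (x ∈ (D j).pts K ↔ x' ∈ (D j).pts K) := by
  classical
  induction S using Finset.induction_on with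
  | empty =>
    refine ⟨Unit, inferInstance, fun _ => Z, ?_, by simp⟩
    rw [Fintype.sum_unique]
    exact chi_eq_one fun _ => subset_rfl
  | insert j S _ ih =>
    obtain ⟨κ, _, A, hA, hAS⟩ := ih
    -- Each part is cut in two by `D j`. Parts may be empty; being a partition is recorded by the
    -- classes of the parts adding up to `1`.
    refine ⟨κ × Bool, inferInstance, fun k => A k.1 ∩ bif k.2 then D j else (D j).compl, ?_, ?_⟩
    · rw [Fintype.sum_prod_type, ← hA]
      refine Finset.sum_congr rfl fun k _ => ?_
      rw [Fintype.sum_bool, ← chi_mul, ← chi_mul, ← mul_add]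
      exact (congrArg _ (chi_add_compl (D j))).trans (mul_one _)
    · rintro ⟨k, b⟩ i hi K x hx x' hx'
      rcases Finset.mem_insert.1 hi with rfl | hi
      · cases b
        · exact iff_of_false hx.2 hx'.2
        · exact iff_of_true hx.2 hx'.2
      · exact hAS k i hi K x hx.1 x' hx'.1

/-- The definable subset of `h[0,m,0]` of the points lying in all fibers of `W` over `A`. -/
def commonFiber (hne : ∀ (K : TField T) s, Nonempty (K.carrier s)) {r : ℕ} (W : Sym (h T 0 0 r))
    (A : DefSet T (hIdx 0 0 r)) : Sym (h T 0 0 0) where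
  m := W.m
  set := ⟨fun K => {x | ∀ z : Pt K.toStruc (hIdx 0 0 r), z ∈ A.pts K → Pt.pair z x ∈ W.set.pts K},
    by
      -- The condition is rewritten as `∀ z, z ∉ A ∨ (z, x) ∈ W`.
      convert IsDef.forallVG (V := relIdx (hIdx 0 0 0) W.m) hne
        ((A.isDef.reindex (W := fun s => relIdx (hIdx 0 0 0) W.m s ⊕ hIdx 0 0 r s)
          fun _ => Sum.inr).compl.union
        (W.set.isDef.reindex (W := fun s => relIdx (hIdx 0 0 0) W.m s ⊕ hIdx 0 0 r s)
          fun _ => Sum.elim Sum.inr fun i => Sum.inl (Sum.inr i))) using 2 with K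
      ext x
      refine forall_congr' fun z => ?_
      have : Pt.reindex (fun _ => Sum.elim Sum.inr fun i => Sum.inl (Sum.inr i)) (x.append z) =
          Pt.pair z x := by
        funext s i
        cases i <;> rfl
      rw [imp_iff_not_or]
      refine or_congr Iff.rfl ?_
      change _ ↔ _ ∈ W.set.pts K
      rw [this]⟩
  sub := fun _ _ _ => trivial

theorem Pt.pair_eq_append {M : Struc L} {r m : ℕ} (z : Pt M (hIdx 0 0 r))
    (y : Pt M (relIdx (hIdx 0 0 0) m)) : Pt.pair z y = z.append fun s i => y s (Sum.inr i) := by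
  funext s i
  cases i <;> rfl

/-- A definable family over `ℤ^r` of subsets of `k^m` is constant on the parts of some finite
definable partition of `ℤ^r`. -/
theorem IsSplit.exists_partition_fiber (hsplit : IsSplit T)
    (hne : ∀ M : Struc L, M.IsModel T → ∀ s, Nonempty (M.carrier s)) {r : ℕ}
    (W : Sym (h T 0 0 r)) :
    ∃ (κ : Type) (_ : Fintype κ) (A : κ → DefSet T (hIdx 0 0 r)),
      ∑ k, chi (h T 0 0 r) (A k) = 1 ∧
      ∀ k, ∀ (K : TField T), ∀ z ∈ (A k).pts K, ∀ z' ∈ (A k).pts K, ∀ y,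
        Pt.pair z y ∈ W.set.pts K → Pt.pair z' y ∈ W.set.pts K := by
  obtain ⟨θ, hθ⟩ := W.set.isDef
  obtain ⟨S, hS⟩ := hsplit.exists_finset_formula hne θ
  -- The partition is cut out by the formulas in `S`, the same for all `T`-fields.
  obtain ⟨κ, hκ, A, hA, hAS⟩ := exists_partition (h T 0 0 r)
    (fun ψ : Formula L (hIdx 0 0 r) [] => ⟨fun K => {x | ψ.Realize x}, ψ, fun _ => rfl⟩) S
  refine ⟨κ, hκ, A, hA, fun k K z hz z' hz' y hy => ?_⟩
  rw [Pt.pair_eq_append, hθ] at hy ⊢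
  exact hS K.toStruc K.isModel _ _ _ (fun ψ hψ => hAS k ψ hψ K _ hz _ hz') hy

/-- Over `A` the family `W` is constant, so it coincides there with `A` times the common fiber. Both
products are the same subset of the same space, and no isomorphism has to be constructed. -/
theorem chi_mul_cls_commonFiber (hne : ∀ (K : TField T) s, Nonempty (K.carrier s)) {r : ℕ}
    (W : Sym (h T 0 0 r)) {A : DefSet T (hIdx 0 0 r)}
    (hA : ∀ (K : TField T), ∀ z ∈ A.pts K, ∀ z' ∈ A.pts K, ∀ y,
      Pt.pair z y ∈ W.set.pts K → Pt.pair z' y ∈ W.set.pts K) :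
    chi (h T 0 0 r) A * W.cls =
      chi (h T 0 0 r) A * Q.ofPt (h T 0 0 r) (commonFiber hne W A).cls := by
  rw [Q.ofPt_cls, chi, Sym.cls_mul, Sym.cls_mul]
  refine congrArg Sym.cls (Sym.ext' _ _ fun K => ?_)
  ext x
  refine and_congr_right fun hx => ?_
  -- The factor `chi` has no residue field coordinates, so the product lives in `0 + W.m` of them;
  -- `w` is `x` with these coordinates indexed by `Fin W.m`.
  set w : Pt K.toStruc (relIdx (hIdx 0 0 r) W.m) := x.reindex (relMap _ (Fin.natAdd 0))
  have hwA : w.base ∈ A.pts K := hx.1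
  have hpair : Pt.pair w.base (w.reindex (ptMap _ W.m)) = w :=
    Pt.ext_pair rfl (Pt.pair_ptMap _ _)
  change w ∈ W.set.pts K ↔ True ∧
    ∀ z ∈ A.pts K, Pt.pair z (w.reindex (ptMap _ W.m)) ∈ W.set.pts K
  rw [true_and]
  constructor
  · intro hwW z hz
    rw [← hpair] at hwW
    exact hA K _ hwA z hz _ hwW
  · intro H
    rw [← hpair]
    exact H _ hwA

/-- If `A(K)` has a point, the common fiber is the fiber of `W` over it, which is nonempty. If
`A(K)` is empty, the condition on the common fiber is vacuous. -/
theorem commonFiber_cls_mem_QStar (hne : ∀ (K : TField T) s, Nonempty (K.carrier s)) {r : ℕ}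
    (W : Sym (h T 0 0 r))
    (hW : ∀ (K : TField T), ∀ z ∈ (h T 0 0 r).pts K, ∃ w ∈ W.set.pts K, w.base = z)
    {A : DefSet T (hIdx 0 0 r)}
    (hA : ∀ (K : TField T), ∀ z ∈ A.pts K, ∀ z' ∈ A.pts K, ∀ y,
      Pt.pair z y ∈ W.set.pts K → Pt.pair z' y ∈ W.set.pts K) :
    (commonFiber hne W A).cls ∈ QStar (h T 0 0 0) := by
  refine ⟨_, rfl, fun K p _ => ?_⟩
  have hbase : ∀ y : Pt K.toStruc (relIdx (hIdx 0 0 0) W.m), y.base = p := fun y => by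
    funext s i
    cases s <;> exact Fin.elim0 i
  by_cases hz : ∃ z, z ∈ A.pts K
  · obtain ⟨z, hz⟩ := hz
    obtain ⟨w, hw, rfl⟩ := hW K z trivial
    have hpair : Pt.pair w.base (w.reindex (ptMap _ W.m)) ∈ W.set.pts K := by
      rwa [show Pt.pair w.base (w.reindex (ptMap _ W.m)) = w from
        Pt.ext_pair rfl (Pt.pair_ptMap _ _)]
    exact ⟨w.reindex (ptMap _ W.m), fun z' hz' => hA K _ hz z' hz' _ hpair, hbase _⟩
  -- Here the common fiber is all of `k_K^m`, so any point will do.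
  · exact ⟨fun s _ => (hne K s).some, fun z hz' => (hz ⟨z, hz'⟩).elim, hbase _⟩

/-! ### Denominators in tensor products with a localization -/

/-- Denominators can be cleared in a base change of a localization. -/
theorem exists_map_eq_mul {R P B : Type*} [CommSemiring R] [CommSemiring P] [CommSemiring B]
    [Algebra R P] [Algebra R B] (S : Submonoid B) (F : P ⊗[R] Localization S) :
    ∃ s ∈ S, ∀ t : B, ∃ G : P ⊗[R] B, Algebra.TensorProduct.map (AlgHom.id R P)
      (IsScalarTower.toAlgHom R B (Localization S)) G =
        (Algebra.TensorProduct.includeRight : Localization S →ₐ[R] P ⊗[R] Localization S)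
          (algebraMap B (Localization S) (t * s)) * F := by
  set f := Algebra.TensorProduct.map (AlgHom.id R P)
    (IsScalarTower.toAlgHom R B (Localization S)) with hf
  have hincl : ∀ a : B, f (1 ⊗ₜ a) = (1 : P) ⊗ₜ algebraMap B (Localization S) a := fun a => by
    simp [hf]
  have hmul : ∀ a b : B, (1 : P) ⊗ₜ[R] (a * b) = (1 ⊗ₜ a) * (1 ⊗ₜ b) := by simp
  simp only [Algebra.TensorProduct.includeRight_apply, ← hincl, map_mul]
  -- The denominator `s` is uniform in `t`: every multiple `t * s` clears denominators too, which
  -- later allows `t * s` to be chosen as a class pulled back from the point.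
  induction F using TensorProduct.induction_on with
  | zero => exact ⟨1, one_mem _, fun t => ⟨0, by rw [map_zero, mul_zero]⟩⟩
  | tmul p q =>
    obtain ⟨⟨a, s⟩, hq⟩ := IsLocalization.surj S q
    -- Since `q * s = a` in the localization, `(t * s) * (p ⊗ q)` is the image of `p ⊗ (t * a)`.
    refine ⟨s, s.2, fun t => ⟨1 ⊗ₜ t * p ⊗ₜ a, ?_⟩⟩
    rw [map_mul, mul_assoc, hincl s, Algebra.TensorProduct.tmul_mul_tmul, one_mul, mul_comm _ q, hq]
    simp [hf]
  | add F F' hF hF' =>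
    obtain ⟨s, hs, hG⟩ := hF
    obtain ⟨s', hs', hG'⟩ := hF'
    refine ⟨s * s', mul_mem hs hs', fun t => ?_⟩
    obtain ⟨G, hG⟩ := hG t
    obtain ⟨G', hG'⟩ := hG' t
    -- The summands, cleared by `t * s` and `t * s'`, are brought to the common denominator `s *
    -- s'`.
    refine ⟨(1 ⊗ₜ s') * G + (1 ⊗ₜ s) * G', ?_⟩
    rw [hmul, map_add, map_mul, map_mul, map_mul, hG, hG']
    ring

/-- Each class without empty fibers over `ℤ^r` divides such a class coming from the point. -/
theorem IsSplit.exists_mul_eq_ofPt (hsplit : IsSplit T)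
    (hne : ∀ M : Struc L, M.IsModel T → ∀ s, Nonempty (M.carrier s)) {r : ℕ}
    {s : Q (h T 0 0 r)} (hs : s ∈ QStar (h T 0 0 r)) :
    ∃ y ∈ QStar (h T 0 0 0), ∃ t, t * s = Q.ofPt (h T 0 0 r) y := by
  classical
  obtain ⟨W, rfl, hW⟩ := hs
  have hne' : ∀ (K : TField T) s, Nonempty (K.carrier s) := fun K => hne K.toStruc K.isModel
  obtain ⟨κ, _, A, hA, hAW⟩ := hsplit.exists_partition_fiber hne W
  let Y : κ → Q (h T 0 0 0) := fun k => (commonFiber hne' W (A k)).cls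
  refine ⟨∏ k, Y k, prod_mem fun k _ => commonFiber_cls_mem_QStar hne' W hW (hAW k),
    -- On the part `A k` the missing factor `Y k` of the product is supplied by `W` itself; the
    -- parts then add up to `1`.
    ∑ k, chi (h T 0 0 r) (A k) * ∏ j ∈ Finset.univ.erase k, Q.ofPt (h T 0 0 r) (Y j), ?_⟩
  rw [Finset.sum_mul, map_prod, ← one_mul (∏ k, Q.ofPt (h T 0 0 r) (Y k)), ← hA, Finset.sum_mul]
  refine Finset.sum_congr rfl fun k _ => ?_
  rw [mul_right_comm, chi_mul_cls_commonFiber hne' W (hAW k), mul_assoc,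
    ← Finset.mul_prod_erase _ _ (Finset.mem_univ k)]

end Denominators

end RatMot

theorem mainTheorem6 {L : RatMot.Lang.{u}} (T : RatMot.Theory L)
    (hT : ∀ M : RatMot.Struc L, M.IsModel T → M.IsHenselianAC0) (hsplit : RatMot.IsSplit T)
    (r : ℕ) (F : RatMot.RatCPlus (RatMot.h T 0 0 r)) :
    ∃ y ∈ RatMot.QStar (RatMot.h T 0 0 0), ∃ G : RatMot.CPlus (RatMot.h T 0 0 r),
      RatMot.CPlus.toRat (RatMot.h T 0 0 r) G =
        RatMot.Q.toRat (RatMot.h T 0 0 r) (RatMot.Q.ofPt (RatMot.h T 0 0 r) y) * F := by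
  obtain ⟨s, hs, H⟩ := RatMot.exists_map_eq_mul (RatMot.QStar (RatMot.h T 0 0 r)) F
  obtain ⟨y, hy, t, ht⟩ := hsplit.exists_mul_eq_ofPt (fun M hM => (hT M hM).nonempty) hs
  -- With this multiplier, `t * s` is the pullback of `y`.
  obtain ⟨G, hG⟩ := H t
  rw [ht] at hG
  exact ⟨y, hy, G, hG⟩
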